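/- Let $k\ge 1$ and let $\mathcal D_{\rm alg}(k)$ be the set of linear functionals $\mu:\mathbb C\langle X_1,\dots,X_k\rangle\to\mathbb C$ with $\mu(1)=1$, i.e. of distributions of $k$-tuples of elements of non-commutative probability spaces. The free multiplicative convolution $\boxtimes$ on $\mathcal D_{\rm alg}(k)$ is determined as follows: if $(a_1,\dots,a_k)$ and $(b_1,\dots,b_k)$ have distributions $\mu$ and $\nu$ in a non-commutative probability space and $\{a_1,\dots,a_k\}$ is freely independent from $\{b_1,\dots,b_k\}$, then $(a_1b_1,\dots,a_kb_k)$ has distribution $\mu\boxtimes\nu$. Its unit $\mu_o$ satisfies $\mu_o(X_{i_1}\cdots X_{i_n})=1$ for all $n \ge 1$ and $i_1,\dots,i_n$. Let $\mathcal G_k=\{\mu\in\mathcal D_{\rm alg}(k) : \mu(X_i)=1 \text{ for } 1\le i\le k\}$. Let $NC(n)$ be the set of non-crossing partitions of $\{1,\dots,n\}$, ordered by $\pi\le\rho$ iff every block of $\rho$ is a union of blocks of $\pi$, with minimum $0_n$ and maximum $1_n$. For $\pi\in NC(n)$ let $P_\pi$ be the permutation with one cycle $b_1\mapsto b_2\mapsto\cdots\mapsto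 b_m\mapsto b_1$ for every block $\{b_1<\cdots<b_m\}$ of $\pi$; for $\pi\le\rho$ in $NC(n)$ let $K_\rho(\pi)\in NC(n)$ be the relative Kreweras complement, determined by $P_{K_\rho(\pi)}=P_\pi^{-1}P_\rho$ (apply $P_\rho$ first). A chain in $NC(n)$ is a tuple $\Gamma=(\pi_0,\dots,\pi_\ell)$ in $NC(n)$ with $0_n=\pi_0<\pi_1<\cdots<\pi_\ell=1_n$, and $|\Gamma|:=\ell$. For a power series $f$ with complex coefficients and zero constant term in non-commuting indeterminates $z_1,\dots,z_k$ and a word $w=(i_1,\dots,i_n)$ over $\{1,\dots,k\}$, let $\mathrm{Cf}_w(f)$ be the coefficient of $z_{i_1}\cdots z_{i_n}$ in $f$. For $\pi\in NC(n)$ put $\mathrm{Cf}_{w;\pi}(f)=\prod_{B}\mathrm{Cf}_{w|B}(f)$, the product being over the blocks $B=\{b_1<\cdots<b_m\}$ of $\pi$, with $w|B=(i_{b_1},\dots,i_{b_m})$. For a chain $\Gamma=(\pi_0,\dots,\pi_\ell)$ in $NC(n)$ put $\mathrm{Cf}^{(\Gamma)}_w(f)=\prod_{j=1}^{\ell}\mathrm{Cf}_{w;K_{\pi_j}(\pi_{j-1})}(f)$.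 The $R$-transform $R_\mu$ of $\mu\in\mathcal D_{\rm alg}(k)$ is the unique such series $f$ with $\mu(X_{i_1}\cdots X_{i_n})=\sum_{\pi\in NC(n)}\mathrm{Cf}_{(i_1,\dots,i_n);\pi}(f)$ for all $n\ge1$ and all $i_1,\dots,i_n$. **Proposition.** Let $\mu\in\mathcal G_k$ and let $\nu$ be the inverse of $\mu$ under $\boxtimes$, that is, $\mu\boxtimes\nu=\mu_o=\nu\boxtimes\mu$. Then for every word $w$ over $\{1,\dots,k\}$ of length $n\ge2$, $$\mathrm{Cf}_w(R_\nu)=\sum_{\Gamma\ \text{chain in}\ NC(n)}(-1)^{|\Gamma|}\,\mathrm{Cf}^{(\Gamma)}_w(R_\mu).$$ -/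

import Mathlib

namespace FreeProb

/-! ### Non-crossing partitions -/

/-- A partition of `{0, …, n-1}` is non-crossing if there are no `a < b < c < d` with `a, c` in one
block and `b, d` in a different block. -/
def IsNonCrossing {n : ℕ} (π : Finpartition (Finset.univ : Finset (Fin n))) : Prop :=
  ∀ B ∈ π.parts, ∀ C ∈ π.parts, ∀ a b c d : Fin n, a < b → b < c → c < d →
    a ∈ B → b ∈ C → c ∈ B → d ∈ C → B = C

/-- The set `NC(n)` of non-crossing partitions of an `n`-element set, ordered (through the subtype
order on `Finpartition`) by: `π ≤ ρ` iff every block of `π` is contained in a block of `ρ`. -/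
abbrev NC (n : ℕ) : Type :=
  {π : Finpartition (Finset.univ : Finset (Fin n)) // IsNonCrossing π}

noncomputable instance (n : ℕ) : Fintype (NC n) := Fintype.ofFinite _

/-- The partition `0_n` into `n` singletons. -/
def NC.zero (n : ℕ) : NC n := ⟨⊥, by
  intro B hB C hC a b c d hab hbc _ ha _ hc _
  rw [Finpartition.mem_bot_iff] at hB
  obtain ⟨x, -, rfl⟩ := hB
  rw [Finset.mem_singleton] at ha hc
  exact absurd (hab.trans hbc) (by rw [ha, hc]; exact lt_irrefl _)⟩

/-- The partition `1_n` with the single block `{0, …, n-1}` (no block at all if `n = 0`). -/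
def NC.one (n : ℕ) : NC n := ⟨⊤, by
  intro B hB C hC a b c d _ _ _ _ _ _ _
  have hB' := Finpartition.parts_top_subset _ hB
  have hC' := Finpartition.parts_top_subset _ hC
  rw [Finset.mem_singleton] at hB' hC'
  rw [hB', hC']⟩

/-- The cyclic permutation `b₁ ↦ b₂ ↦ ⋯ ↦ b_m ↦ b₁` of a set `B = {b₁ < ⋯ < b_m}`, fixing all the
points outside `B`. -/
def blockCycle {n : ℕ} (B : Finset (Fin n)) : Equiv.Perm (Fin n) :=
  (B.sort (· ≤ ·)).formPerm

theorem blockCycle_mem_iff {n : ℕ} (B : Finset (Fin n)) (x : Fin n) :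
    blockCycle B x ∈ B ↔ x ∈ B := by
  have h := List.formPerm_mem_iff_mem (l := B.sort (· ≤ ·)) (x := x)
  rw [Finset.mem_sort, Finset.mem_sort] at h
  exact h

theorem blockCycle_symm_mem_iff {n : ℕ} (B : Finset (Fin n)) (x : Fin n) :
    (blockCycle B).symm x ∈ B ↔ x ∈ B := by
  rw [← blockCycle_mem_iff, Equiv.apply_symm_apply]

/-- The permutation `P_π` associated to a partition `π`: on every block `{b₁ < ⋯ < b_m}` of `π` it
is the cycle `b₁ ↦ b₂ ↦ ⋯ ↦ b_m ↦ b₁`. -/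
def perm {n : ℕ} (π : Finpartition (Finset.univ : Finset (Fin n))) : Equiv.Perm (Fin n) where
  toFun x := blockCycle (π.part x) x
  invFun x := (blockCycle (π.part x)).symm x
  left_inv x := by
    have h : π.part (blockCycle (π.part x) x) = π.part x :=
      π.part_eq_of_mem (π.part_mem.2 (Finset.mem_univ _))
        ((blockCycle_mem_iff _ _).2 (π.mem_part_self.2 (Finset.mem_univ _)))
    simp only [h, Equiv.symm_apply_apply]
  right_inv x := by
    have h : π.part ((blockCycle (π.part x)).symm x) = π.part x :=
      π.part_eq_of_mem (π.part_mem.2 (Finset.mem_univ _))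
        ((blockCycle_symm_mem_iff _ _).2 (π.mem_part_self.2 (Finset.mem_univ _)))
    simp only [h, Equiv.apply_symm_apply]

/-- The relative Kreweras complement `K_ρ(π)` of `π` in `ρ` (for `π ≤ ρ` in `NC(n)`): the partition
whose associated permutation is `P_π⁻¹ P_ρ` (first apply `P_ρ`, then `P_π⁻¹`). As the blocks of a
partition are the cycles of its associated permutation (see `eq_relKreweras`), the blocks of
`K_ρ(π)` are the cycles (including the fixed points) of `P_π⁻¹ P_ρ`. -/
noncomputable def relKreweras {n : ℕ} (ρ π : NC n) :
    Finpartition (Finset.univ : Finset (Fin n)) :=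
  haveI := Classical.decRel (Equiv.Perm.SameCycle.setoid ((perm π.1)⁻¹ * perm ρ.1))
  Finpartition.ofSetoid (Equiv.Perm.SameCycle.setoid ((perm π.1)⁻¹ * perm ρ.1))

theorem sameCycle_blockCycle {n : ℕ} {B : Finset (Fin n)} {x y : Fin n} (hx : x ∈ B) (hy : y ∈ B) :
    (blockCycle B).SameCycle x y := by
  by_cases hxy : x = y
  · exact hxy ▸ Equiv.Perm.SameCycle.refl _ _
  have hlen : 2 ≤ (B.sort (· ≤ ·)).length := by
    rw [Finset.length_sort]
    exact Finset.one_lt_card.2 ⟨x, hx, y, hy, hxy⟩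
  have hnd := B.sort_nodup (· ≤ ·)
  have hc := List.isCycle_formPerm hnd hlen
  exact hc.sameCycle
    ((List.formPerm_apply_mem_ne_self_iff _ hnd x ((Finset.mem_sort _).2 hx)).2 hlen)
    ((List.formPerm_apply_mem_ne_self_iff _ hnd y ((Finset.mem_sort _).2 hy)).2 hlen)

theorem part_perm {n : ℕ} (π : Finpartition (Finset.univ : Finset (Fin n))) (x : Fin n) :
    π.part (perm π x) = π.part x :=
  π.part_eq_of_mem (π.part_mem.2 (Finset.mem_univ _))
    ((blockCycle_mem_iff _ _).2 (π.mem_part_self.2 (Finset.mem_univ _)))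

theorem perm_pow_apply {n : ℕ} (π : Finpartition (Finset.univ : Finset (Fin n))) (x : Fin n)
    (i : ℕ) : (perm π ^ i) x = (blockCycle (π.part x) ^ i) x ∧
      π.part ((perm π ^ i) x) = π.part x := by
  induction i with
  | zero => simp
  | succ i ih =>
    refine ⟨?_, by rw [pow_succ', Equiv.Perm.mul_apply, part_perm, ih.2]⟩
    rw [pow_succ', pow_succ', Equiv.Perm.mul_apply, Equiv.Perm.mul_apply, ← ih.1]
    change blockCycle (π.part ((perm π ^ i) x)) _ = _
    rw [ih.2]

/-- The cycles of `P_π` are the blocks of `π`. -/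
theorem sameCycle_perm_iff {n : ℕ} (π : Finpartition (Finset.univ : Finset (Fin n)))
    (x y : Fin n) : (perm π).SameCycle x y ↔ y ∈ π.part x := by
  constructor
  · intro h
    obtain ⟨i, -, rfl⟩ := h.exists_pow_eq'
    rw [ ← (perm_pow_apply π x i).2]
    exact π.mem_part_self.2 (Finset.mem_univ _)
  · intro h
    obtain ⟨i, -, hi⟩ :=
      (sameCycle_blockCycle (π.mem_part_self.2 (Finset.mem_univ x)) h).exists_pow_eq'
    exact ⟨i, by rw [zpow_natCast, (perm_pow_apply π x i).1, hi]⟩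

/-- `K_ρ(π)` is the partition `K` that is determined by `P_K = P_π⁻¹ P_ρ`. -/
theorem eq_relKreweras {n : ℕ} {ρ π : NC n} {K : Finpartition (Finset.univ : Finset (Fin n))}
    (h : perm K = (perm π.1)⁻¹ * perm ρ.1) : K = relKreweras ρ π := by
  have hpart : ∀ x, K.part x = (relKreweras ρ π).part x := by
    intro x
    ext y
    rw [← sameCycle_perm_iff, h]
    exact (@Finpartition.mem_part_ofSetoid_iff_rel _ _ x _
      (Equiv.Perm.SameCycle.setoid ((perm π.1)⁻¹ * perm ρ.1)) (_) y).symm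
  have hparts : ∀ P : Finpartition (Finset.univ : Finset (Fin n)),
      P.parts = Finset.univ.image P.part := by
    intro P
    ext B
    simp only [Finset.mem_image, Finset.mem_univ, true_and]
    constructor
    · intro hB
      obtain ⟨x, hx⟩ := P.nonempty_of_mem_parts hB
      exact ⟨x, P.part_eq_of_mem hB hx⟩
    · rintro ⟨x, rfl⟩
      exact P.part_mem.2 (Finset.mem_univ _)
  apply Finpartition.ext
  rw [hparts K, hparts (relKreweras ρ π), funext hpart]

/-- A chain `0_n = π₀ < π₁ < ⋯ < π_ℓ = 1_n` in `NC(n)`. Its length `ℓ` is `Γ.1.length`, and `π_j`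
is `Γ.1 j`. -/
abbrev Chain (n : ℕ) : Type :=
  {Γ : LTSeries (NC n) // Γ.head = NC.zero n ∧ Γ.last = NC.one n}

noncomputable instance (n : ℕ) : Fintype (Chain n) := by
  classical
  exact Subtype.fintype _

/-! ### Power series in non-commuting indeterminates -/

/-- The series with complex coefficients and vanishing constant term in the non-commuting
indeterminates `z_0, …, z_{k-1}`. Words over the alphabet `Fin k` are lists; `coeff w` is the
coefficient of `z_w`. -/
@[ext]
structure Series (k : ℕ) where
  coeff : List (Fin k) → ℂ
  coeff_nil : coeff [] = 0

/-- The restriction `w | B = (i_{b₁}, …, i_{b_m})` of a word `w = (i_1, …, i_n)` to a set of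
positions `B = {b₁ < ⋯ < b_m}`. -/
def restrictWord {k n : ℕ} (w : Fin n → Fin k) (B : Finset (Fin n)) : List (Fin k) :=
  (B.sort (· ≤ ·)).map w

/-- The coefficient `Cf_w(f)` of `z_w` in `f`. -/
def Cf {k n : ℕ} (w : Fin n → Fin k) (f : Series k) : ℂ := f.coeff (List.ofFn w)

/-- `Cf_{w;π}(f) = ∏_{B block of π} Cf_{w|B}(f)`. -/
def CfPart {k n : ℕ} (w : Fin n → Fin k) (π : Finpartition (Finset.univ : Finset (Fin n)))
    (f : Series k) : ℂ :=
  ∏ B ∈ π.parts, f.coeff (restrictWord w B)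

/-- The generalized coefficient `Cf_w^{(Γ)}(f) = ∏_{j=1}^ℓ Cf_{w; K_{π_j}(π_{j-1})}(f)` for a chain
`Γ = (π₀, …, π_ℓ)`. -/
noncomputable def CfChain {k n : ℕ} (w : Fin n → Fin k) (Γ : Chain n) (f : Series k) : ℂ :=
  ∏ j : Fin Γ.1.length, CfPart w (relKreweras (Γ.1 j.succ) (Γ.1 j.castSucc)) f

/-! ### Distributions -/

/-- A linear functional `φ : A → ℂ` on a unital complex algebra with `φ(1) = 1`. The pair `(A, φ)`
is then a non-commutative probability space. -/
structure UnitalFunctional (A : Type) [Ring A] [Algebra ℂ A] where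
  toLinearMap : A →ₗ[ℂ] ℂ
  map_one : toLinearMap 1 = 1

instance (A : Type) [Ring A] [Algebra ℂ A] : CoeFun (UnitalFunctional A) (fun _ => A → ℂ) :=
  ⟨fun φ => φ.toLinearMap⟩

/-- The set `D_alg(k)` of distributions of `k`-tuples: linear functionals `μ` on the algebra
`ℂ⟨X_0, …, X_{k-1}⟩` of non-commutative polynomials, with `μ(1) = 1`. -/
abbrev Distribution (k : ℕ) : Type := UnitalFunctional (FreeAlgebra ℂ (Fin k))

/-- The monomial `X_{i_1} ⋯ X_{i_n}`. -/
def monomial {k : ℕ} (w : List (Fin k)) : FreeAlgebra ℂ (Fin k) :=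
  (w.map (FreeAlgebra.ι ℂ)).prod

/-- The distribution of a `k`-tuple `(a_0, …, a_{k-1})` in a non-commutative probability space
`(A, φ)`: the functional `P ↦ φ(P(a_0, …, a_{k-1}))`. -/
def distribution {A : Type} [Ring A] [Algebra ℂ A] (φ : UnitalFunctional A) {k : ℕ}
    (a : Fin k → A) : Distribution k where
  toLinearMap := φ.toLinearMap ∘ₗ (FreeAlgebra.lift ℂ a).toLinearMap
  map_one := by simp [φ.map_one]

/-- The set `G_k` of distributions with `μ(X_i) = 1` for all `i`. -/
def G (k : ℕ) : Set (Distribution k) := {μ | ∀ i, μ (FreeAlgebra.ι ℂ i) = 1}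

/-! ### Free multiplicative convolution -/

/-- Free independence of a family of unital subalgebras of `(A, φ)`: `φ(x_0 x_1 ⋯ x_n) = 0` whenever
every `x_j` is a centered element of the subalgebra with index `c j` and neighbouring indices are
distinct. -/
def FreelyIndependent {A : Type} [Ring A] [Algebra ℂ A] (φ : UnitalFunctional A) {ι : Type}
    (𝒜 : ι → Subalgebra ℂ A) : Prop :=
  ∀ (n : ℕ) (c : Fin (n + 1) → ι) (x : Fin (n + 1) → A),
    (∀ j : Fin n, c j.castSucc ≠ c j.succ) → (∀ j, x j ∈ 𝒜 (c j)) → (∀ j, φ (x j) = 0) →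
    φ (List.ofFn x).prod = 0

/-- Two sets `S, T ⊆ A` are freely independent if the unital subalgebras that they generate are. -/
def FreelyIndependentSets {A : Type} [Ring A] [Algebra ℂ A] (φ : UnitalFunctional A)
    (S T : Set A) : Prop :=
  FreelyIndependent φ (fun i : Bool => Algebra.adjoin ℂ (cond i S T))

/-- `IsFreeMulConv μ ν ρ` says that `ρ = μ ⊠ ν`: there are `k`-tuples `(a_i)` and `(b_i)` with
distributions `μ` and `ν` in a non-commutative probability space, freely independent from each
other, such that `(a_i b_i)` has distribution `ρ`. (For given `μ` and `ν` such tuples exist, and `ρ`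
does not depend on their choice.) -/
def IsFreeMulConv {k : ℕ} (μ ν ρ : Distribution k) : Prop :=
  ∃ (A : Type) (_ : Ring A) (_ : Algebra ℂ A) (φ : UnitalFunctional A) (a b : Fin k → A),
    FreelyIndependentSets φ (Set.range a) (Set.range b) ∧
    distribution φ a = μ ∧ distribution φ b = ν ∧ distribution φ (fun i => a i * b i) = ρ

/-- The unit `μ_o` of `⊠`, with `μ_o(X_{i_1} ⋯ X_{i_n}) = 1` for all words: evaluation of
polynomials at `(1, …, 1)`. -/
def unitDistribution (k : ℕ) : Distribution k where
  toLinearMap := (FreeAlgebra.lift ℂ (fun _ : Fin k => (1 : ℂ))).toLinearMap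
  map_one := by simp

/-- `ν` is the inverse of `μ` under `⊠`, that is, `μ ⊠ ν = μ_o = ν ⊠ μ`. -/
def IsFreeMulInverse {k : ℕ} (μ ν : Distribution k) : Prop :=
  IsFreeMulConv μ ν (unitDistribution k) ∧ IsFreeMulConv ν μ (unitDistribution k)

/-! ### The `R`-transform -/

/-- The free moment-cumulant formula
`μ(X_{i_1} ⋯ X_{i_n}) = ∑_{π ∈ NC(n)} Cf_{(i_1, …, i_n); π}(f)` for all words of length `n ≥ 1`. -/
def IsRTransform {k : ℕ} (μ : Distribution k) (f : Series k) : Prop :=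
  ∀ (n : ℕ), 1 ≤ n → ∀ w : Fin n → Fin k,
    μ (monomial (List.ofFn w)) = ∑ π : NC n, CfPart w π.1 f

theorem card_lt_of_mem_parts {n : ℕ} {π : NC n} (hπ : π ≠ NC.one n) {B : Finset (Fin n)}
    (hB : B ∈ π.1.parts) : B.card < n := by
  have hle : B.card ≤ n := by simpa using Finset.card_le_univ B
  refine lt_of_le_of_ne hle fun hcard => hπ ?_
  have hBu : B = Finset.univ := by
    rw [← Finset.card_eq_iff_eq_univ, hcard, Fintype.card_fin]
  apply Subtype.ext
  refine le_antisymm le_top ?_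
  intro C hC
  exact ⟨B, hB, by rw [hBu]; exact Finset.subset_univ C⟩

theorem CfPart_one {k n : ℕ} (hn : 1 ≤ n) (w : Fin n → Fin k) (f : Series k) :
    CfPart w (NC.one n).1 f = Cf w f := by
  have hne : (Finset.univ : Finset (Fin n)) ≠ ⊥ := by
    have : Nonempty (Fin n) := ⟨⟨0, hn⟩⟩
    exact Finset.univ_nonempty.ne_empty
  have hp : (⊤ : Finpartition (Finset.univ : Finset (Fin n))).parts = {Finset.univ} := by
    refine (Finset.subset_singleton_iff.1 (Finpartition.parts_top_subset _)).resolve_left ?_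
    exact (Finpartition.parts_nonempty _ hne).ne_empty
  simp only [CfPart, NC.one, hp, Finset.prod_singleton, Cf, restrictWord]
  rw [Fin.sort_univ, List.ofFn_eq_map]

theorem sum_CfPart {k n : ℕ} (hn : 1 ≤ n) (w : Fin n → Fin k) (f : Series k) :
    ∑ π : NC n, CfPart w π.1 f = Cf w f +
      ∑ π ∈ (Finset.univ : Finset (NC n)).filter (· ≠ NC.one n), CfPart w π.1 f := by
  rw [← CfPart_one hn, Finset.filter_ne']
  exact (Finset.add_sum_erase _ (fun π : NC n => CfPart w π.1 f) (Finset.mem_univ _)).symm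

/-- The recursion that solves the moment-cumulant formula for the coefficients. -/
noncomputable def cumulant {k : ℕ} (m : List (Fin k) → ℂ) (l : List (Fin k)) : ℂ :=
  if l = [] then 0 else
    m l - ∑ π ∈ (Finset.univ : Finset (NC l.length)).filter (· ≠ NC.one l.length),
      ∏ B ∈ π.1.parts,
        if (restrictWord l.get B).length < l.length then cumulant m (restrictWord l.get B) else 0
termination_by l.length

theorem cumulant_nil {k : ℕ} (m : List (Fin k) → ℂ) : cumulant m [] = 0 := by
  rw [cumulant, if_pos rfl]

theorem cumulant_of_ne_nil {k : ℕ} (m : List (Fin k) → ℂ) {l : List (Fin k)} (hl : l ≠ []) :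
    cumulant m l = m l -
      ∑ π ∈ (Finset.univ : Finset (NC l.length)).filter (· ≠ NC.one l.length),
        ∏ B ∈ π.1.parts,
          if (restrictWord l.get B).length < l.length then cumulant m (restrictWord l.get B)
          else 0 := by
  rw [cumulant.eq_1, if_neg hl]

theorem length_restrictWord {k n : ℕ} (w : Fin n → Fin k) (B : Finset (Fin n)) :
    (restrictWord w B).length = B.card := by
  simp [restrictWord]

theorem IsRTransform.unique {k : ℕ} {μ : Distribution k} {f g : Series k}
    (hf : IsRTransform μ f) (hg : IsRTransform μ g) : f = g := by
  have key : ∀ (n : ℕ) (w : Fin n → Fin k), Cf w f = Cf w g := by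
    intro n
    induction n using Nat.strong_induction_on with
    | _ n ih =>
      intro w
      rcases Nat.eq_zero_or_pos n with rfl | hn
      · simp [Cf, f.coeff_nil, g.coeff_nil]
      have h := (hf n hn w).symm.trans (hg n hn w)
      rw [sum_CfPart hn, sum_CfPart hn] at h
      have hsum : ∑ π ∈ (Finset.univ : Finset (NC n)).filter (· ≠ NC.one n), CfPart w π.1 f =
          ∑ π ∈ (Finset.univ : Finset (NC n)).filter (· ≠ NC.one n), CfPart w π.1 g := by
        refine Finset.sum_congr rfl fun π hπ => Finset.prod_congr rfl fun B hB => ?_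
        have hlt : (restrictWord w B).length < n := by
          rw [length_restrictWord]
          exact card_lt_of_mem_parts (Finset.mem_filter.1 hπ).2 hB
        have := ih _ hlt (restrictWord w B).get
        simpa only [Cf, List.ofFn_get] using this
      rw [hsum] at h
      exact add_right_cancel h
  ext l
  simpa only [Cf, List.ofFn_get] using key l.length l.get

/-- Every distribution has exactly one `R`-transform. -/
theorem existsUnique_isRTransform {k : ℕ} (μ : Distribution k) :
    ∃! f : Series k, IsRTransform μ f := by
  have hex : IsRTransform μ ⟨cumulant fun l => μ (monomial l), cumulant_nil _⟩ := by
    intro n hn w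
    obtain ⟨l, hl⟩ := List.equivSigmaTuple.surjective (⟨n, w⟩ : Σ n, Fin n → Fin k)
    change (⟨l.length, l.get⟩ : Σ n, Fin n → Fin k) = ⟨n, w⟩ at hl
    cases hl
    have h := cumulant_of_ne_nil (fun l => μ (monomial l)) (List.ne_nil_of_length_pos hn)
    rw [sum_CfPart hn]
    simp only [Cf, List.ofFn_get]
    rw [eq_sub_iff_add_eq] at h
    rw [← h]
    congr 1
    refine Finset.sum_congr rfl fun π hπ => Finset.prod_congr rfl fun B hB => ?_
    rw [if_pos]
    rw [length_restrictWord]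
    exact card_lt_of_mem_parts (Finset.mem_filter.1 hπ).2 hB
  exact ⟨_, hex, fun g hg => IsRTransform.unique hg hex⟩

/-- The `R`-transform `R_μ` of a distribution `μ`: the series determined by the moment-cumulant
formula. -/
noncomputable def RTransform {k : ℕ} (μ : Distribution k) : Series k :=
  (existsUnique_isRTransform μ).choose

theorem isRTransform_RTransform {k : ℕ} (μ : Distribution k) : IsRTransform μ (RTransform μ) :=
  (existsUnique_isRTransform μ).choose_spec.1

end FreeProb

/-! Write `f` for the `R`-transform of `μ` and `g` for that of `ν`. Free multiplicative convolution
becomes boxed convolution of `R`-transforms: the coefficient of `w` in the `R`-transform of `ν ⊠ μ`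
is the sum over `π ∈ NC(n)` of `Cf_{w;π}(g) Cf_{w;K(π)}(f)`. Since `ν ⊠ μ = μ_o` has `R`-transform
`z_1 + ⋯ + z_k`, multiplying this formula over the blocks of a partition `ρ ≠ 0_n` gives `∑_{π ≤ ρ}
Cf_{w;π}(g) Cf_{w;K_ρ(π)}(f) = 0`. The term `π = ρ` is `Cf_{w;ρ}(g)`, because `K_ρ(ρ)` has only
singletons and the linear coefficients of `f` are `1`. So `Cf_{w;ρ}(g)` is minus a sum over `π < ρ`;
iterating this down to `0_n` (`eq_sum_chains`) produces one sign and one Kreweras factor per step of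
a chain, and `ρ = 1_n` is the claim.

The boxed convolution formula is proved from the definition of freeness, with a full Fock space
model written on the dual side. Vectors are replaced by functionals on words, `act` is the transpose
of a canonical operator, and `fock` computes moments from cumulants. Two families with vanishing
mixed cumulants (`jointCumulant`) are free in the vacuum state, and freeness determines joint
moments, so the model computes those of any free pair (`eq_vacuumExp_of_freelyIndependent`). The map
`theta` intertwines the products of the two canonical operators with canonical operators whose
cumulants are the boxed convolution (`theta_act_act`, `fock_alternate`).

What remains is to identify the recursion `box` on words with sums over non-crossing partitions.
`sum_ncp_insert` decomposes a partition along the first two elements of the block of its least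
point, which gives `ncpSum_eq_box`. `part_relKreweras` describes the cycles of `P_π⁻¹ P_ρ` by
intervals that are unions of blocks, and `sum_CfPart_mul_CfPart_relKreweras` splits a sum over `π ≤
ρ` into a product over the blocks of `ρ`. -/

namespace FreeProb

/-! ### Functionals on words -/

section Words

variable {β : Type*}

/-- Left shift of a functional on words: `shift x H s = H (x s)`. -/
def shift (x : β) (H : List β → ℂ) : List β → ℂ := fun s => H (x :: s)

@[simp] theorem shift_apply (x : β) (H : List β → ℂ) (s : List β) : shift x H s = H (x :: s) := rfl

/-- The convolution `(H ⋆ G)(s) = ∑_{s = s' s''} H(s') G(s'')` of functionals on words. -/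
def conv : (List β → ℂ) → (List β → ℂ) → List β → ℂ
  | H, G, [] => H [] * G []
  | H, G, x :: s => H [] * G (x :: s) + conv (shift x H) G s

/-- The sum `∑_{s = s₁ z s₂} H(s₁) K_z(s₂)` over the letters `z` of a word `s`. -/
def cutSum : (List β → ℂ) → (β → List β → ℂ) → List β → ℂ
  | _, _, [] => 0
  | H, K, z :: s => H [] * K z s + cutSum (shift z H) K s

/-- In a factorisation of `s`, the second factor is either empty or determined by the position of
its first letter. -/
theorem conv_eq_add_cutSum (H G : List β → ℂ) (s : List β) :
    conv H G s = H s * G [] + cutSum H (fun z => shift z G) s := by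
  induction s generalizing H with
  | nil => simp [conv, cutSum]
  | cons x s ih => simp [conv, cutSum, ih]; ring

theorem conv_add_left (H H' G : List β → ℂ) (s : List β) :
    conv (H + H') G s = conv H G s + conv H' G s := by
  induction s generalizing H H' with
  | nil => simp [conv]; ring
  | cons x s ih =>
    have : shift x (H + H') = shift x H + shift x H' := rfl
    simp [conv, this, ih]; ring

theorem conv_smul_left (c : ℂ) (H G : List β → ℂ) (s : List β) :
    conv (c • H) G s = c * conv H G s := by
  induction s generalizing H with
  | nil => simp [conv]; ring
  | cons x s ih =>
    have : shift x (c • H) = c • shift x H := rfl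
    simp [conv, this, ih]; ring

theorem conv_add_right (H G G' : List β → ℂ) (s : List β) :
    conv H (G + G') s = conv H G s + conv H G' s := by
  induction s generalizing H with
  | nil => simp [conv]; ring
  | cons x s ih => simp [conv, ih]; ring

theorem conv_smul_right (c : ℂ) (H G : List β → ℂ) (s : List β) :
    conv H (c • G) s = c * conv H G s := by
  induction s generalizing H with
  | nil => simp [conv]; ring
  | cons x s ih => simp [conv, ih]; ring

theorem shift_conv (x : β) (H G : List β → ℂ) :
    shift x (conv H G) = H [] • shift x G + conv (shift x H) G := rfl

theorem shift_cutSum (x : β) (H : List β → ℂ) (K : β → List β → ℂ) :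
    shift x (cutSum H K) = H [] • K x + cutSum (shift x H) K := rfl

theorem conv_assoc (H G R : List β → ℂ) : conv (conv H G) R = conv H (conv G R) := by
  funext s
  induction s generalizing H with
  | nil => simp [conv]; ring
  | cons x s ih =>
    rw [conv, shift_conv, conv_add_left, conv_smul_left, ih]
    simp [conv]; ring

theorem cutSum_conv (H : List β → ℂ) (K : β → List β → ℂ) (R : List β → ℂ) :
    conv (cutSum H K) R = cutSum H (fun z => conv (K z) R) := by
  funext s
  induction s generalizing H with
  | nil => simp [conv, cutSum]
  | cons x s ih =>
    rw [conv, shift_cutSum, conv_add_left, conv_smul_left, ih]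
    simp [cutSum]

/-- Both pieces of a cut omit the letter `z`, so they are strictly shorter than `s`. This is what
closes the later inductions on word length. -/
theorem cutSum_congr {H H' : List β → ℂ} {K K' : β → List β → ℂ} {s : List β}
    (hH : ∀ u, u.length < s.length → H u = H' u)
    (hK : ∀ z u, u.length < s.length → K z u = K' z u) : cutSum H K s = cutSum H' K' s := by
  induction s generalizing H H' with
  | nil => rfl
  | cons x s ih =>
    rw [cutSum, cutSum, hH [] (by simp), hK x s (by simp)]
    congr 1
    exact ih (fun u hu => hH _ (by simpa using hu)) (fun z u hu => hK z u (by simp; omega))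

theorem cutSum_add (H : List β → ℂ) (K K' : β → List β → ℂ) (s : List β) :
    cutSum H (fun z u => K z u + K' z u) s = cutSum H K s + cutSum H K' s := by
  induction s generalizing H with
  | nil => simp [cutSum]
  | cons x s ih => simp [cutSum, ih]; ring

theorem cutSum_smul (c : ℂ) (H : List β → ℂ) (K : β → List β → ℂ) (s : List β) :
    cutSum H (fun z u => c * K z u) s = c * cutSum H K s := by
  induction s generalizing H with
  | nil => simp [cutSum]
  | cons x s ih => simp [cutSum, ih]; ring

/-- The functional that detects the empty word. -/
def vac : List β → ℂ
  | [] => 1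
  | _ :: _ => 0

@[simp] theorem vac_nil : vac ([] : List β) = 1 := rfl
@[simp] theorem vac_cons (x : β) (s : List β) : vac (x :: s) = 0 := rfl
@[simp] theorem shift_vac (x : β) : shift x (vac : List β → ℂ) = 0 := rfl

@[simp] theorem conv_zero_left (G : List β → ℂ) : conv 0 G = 0 := by
  funext s
  simpa using conv_smul_left 0 0 G s

theorem vac_conv (G : List β → ℂ) : conv vac G = G := by
  funext s
  cases s <;> simp [conv]

theorem conv_vac (G : List β → ℂ) : conv G vac = G := by
  funext s
  induction s generalizing G with
  | nil => simp [conv]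
  | cons x s ih => simp [conv, ih]

/-! ### Fock space operators, acting on functionals -/

/-- The transpose of the canonical operator `ℓ_x + ∑_u κ(x u) ℓ_u^*` on the full Fock space. -/
def act (κ : List β → ℂ) (x : β) (G : List β → ℂ) : List β → ℂ :=
  fun s => G (x :: s) + conv (shift x κ) G s

theorem act_eq (κ : List β → ℂ) (x : β) (G : List β → ℂ) :
    act κ x G = shift x G + conv (shift x κ) G := rfl

theorem act_add (κ : List β → ℂ) (x : β) (G G' : List β → ℂ) :
    act κ x (G + G') = act κ x G + act κ x G' := by
  funext s
  simp [act, conv_add_right]; ring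

theorem act_smul (κ : List β → ℂ) (x : β) (c : ℂ) (G : List β → ℂ) :
    act κ x (c • G) = c • act κ x G := by
  funext s
  simp [act, conv_smul_right]; ring

/-- The functional `G` evaluated at the image of the vacuum under a product of canonical
operators. -/
def fock (κ : List β → ℂ) : (List β → ℂ) → List β → ℂ
  | G, [] => G []
  | G, x :: w => fock κ (act κ x G) w

theorem fock_add (κ G G' : List β → ℂ) (w : List β) :
    fock κ (G + G') w = fock κ G w + fock κ G' w := by
  induction w generalizing G G' with
  | nil => rfl
  | cons x w ih => rw [fock, act_add, ih]; rfl

theorem fock_smul (κ : List β → ℂ) (c : ℂ) (G : List β → ℂ) (w : List β) :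
    fock κ (c • G) w = c * fock κ G w := by
  induction w generalizing G with
  | nil => rfl
  | cons x w ih => rw [fock, act_smul, ih]; rfl

/-- The letter passes to `G` only if `H` expects nothing more; in all other cases, including the
opening of a new block in front, only `H` changes. -/
theorem act_conv (κ : List β → ℂ) (x : β) (H G : List β → ℂ) :
    act κ x (conv H G) = H [] • shift x G + conv (act κ x H) G := by
  funext s
  rw [act_eq, shift_conv, ← conv_assoc, act_eq κ x H]
  simp [conv_add_left]; ring

/-- `H` must be served before `G`, so the word is cut at the first letter `y` that `G` receives; the
part before `y` is evaluated against `H` alone. -/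
theorem fock_conv (κ H G : List β → ℂ) (w : List β) :
    fock κ (conv H G) w = fock κ H w * G [] +
      cutSum (fock κ H) (fun y => fock κ (shift y G)) w := by
  induction w generalizing H with
  | nil => simp [fock, conv, cutSum]
  | cons x w ih =>
    have h : shift x (fock κ H) = fock κ (act κ x H) := rfl
    rw [fock, act_conv, fock_add, fock_smul, ih, cutSum, h]
    simp [fock]; ring

/-- Decomposition according to the first open letter. -/
theorem fock_eq (κ H : List β → ℂ) (w : List β) :
    fock κ H w = H [] * fock κ vac w +
      cutSum (fock κ vac) (fun y => fock κ (shift y H)) w := by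
  have h := fock_conv κ vac H w
  rw [vac_conv] at h
  rw [h]; ring

/-! ### Boxed convolution on words -/

/-- Auxiliary recursion for `blockSum`: `C` is the functional for the current gap. -/
def blockSumAux (c K : β → List β → ℂ) : (List β → ℂ) → (List β → ℂ) → List β → ℂ
  | _, _, [] => 0
  | C, H, z :: s => C [] * (H [z] * K z s + blockSumAux c K (c z) (shift z H) s) +
      blockSumAux c K (shift z C) H s

/-- The sum, over all the ways to write `s = s₁ v₁ s₂ v₂ ⋯ s_r v_r s'`, of
`H(v₁ ⋯ v_r) c_x(s₁) c_{v₁}(s₂) ⋯ c_{v_{r-1}}(s_r) K_{v_r}(s')` (and `H(∅) K_x(s)` for `r = 0`). -/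
def blockSum (c K : β → List β → ℂ) (H : List β → ℂ) (x : β) (s : List β) : ℂ :=
  H [] * K x s + blockSumAux c K (c x) H s

theorem blockSumAux_eq (c K : β → List β → ℂ) (C H : List β → ℂ) (s : List β) :
    blockSumAux c K C H s = cutSum C (fun z => blockSum c K (shift z H) z) s := by
  induction s generalizing C with
  | nil => rfl
  | cons z s ih => rw [blockSumAux, ih (shift z C), cutSum]; rfl

/-- Splitting off `s₁ v₁` leaves a sum of the same kind, started at `v₁` with `v₁` removed from the
argument of `H`. -/
theorem blockSum_eq (c K : β → List β → ℂ) (H : List β → ℂ) (x : β) (s : List β) :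
    blockSum c K H x s =
      H [] * K x s + cutSum (c x) (fun z => blockSum c K (shift z H) z) s := by
  rw [blockSum, blockSumAux_eq]

theorem blockSum_congr {c c' K K' : β → List β → ℂ} (H : List β → ℂ) (x : β) {s : List β}
    (hc : ∀ z u, u.length ≤ s.length → c z u = c' z u)
    (hK : ∀ z u, u.length ≤ s.length → K z u = K' z u) :
    blockSum c K H x s = blockSum c' K' H x s := by
  induction h : s.length using Nat.strong_induction_on generalizing s H x with
  | _ n ih =>
    rw [blockSum_eq, blockSum_eq, hK x s le_rfl]
    congr 1
    refine cutSum_congr (fun u hu => hc x u hu.le) fun z u hu => ?_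
    exact ih _ (h ▸ hu) _ _ (fun z v hv => hc z v (hv.trans hu.le))
      (fun z v hv => hK z v (hv.trans hu.le)) rfl

theorem blockSum_add (c K K' : β → List β → ℂ) (H : List β → ℂ) (x : β) (s : List β) :
    blockSum c (fun z u => K z u + K' z u) H x s =
      blockSum c K H x s + blockSum c K' H x s := by
  induction h : s.length using Nat.strong_induction_on generalizing s H x with
  | _ n ih =>
    rw [blockSum_eq, blockSum_eq, blockSum_eq, cutSum_congr (fun u _ => rfl)
      fun z u hu => ih _ (h ▸ hu) _ _ _ rfl, cutSum_add]
    ring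

theorem blockSum_smul (c K : β → List β → ℂ) (a : ℂ) (H : List β → ℂ) (x : β) (s : List β) :
    blockSum c (fun z u => a * K z u) H x s = a * blockSum c K H x s := by
  induction h : s.length using Nat.strong_induction_on generalizing s H x with
  | _ n ih =>
    rw [blockSum_eq, blockSum_eq, cutSum_congr (fun u _ => rfl)
      fun z u hu => ih _ (h ▸ hu) _ _ _ rfl, cutSum_smul]
    ring

/-- `K` receives the last piece of the word, so a suffix for `R` may be cut off before or after the
other pieces are chosen. -/
theorem blockSum_conv (c K : β → List β → ℂ) (R : List β → ℂ) (H : List β → ℂ) (x : β)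
    (s : List β) :
    blockSum c (fun z => conv (K z) R) H x s = conv (blockSum c K H x) R s := by
  induction h : s.length using Nat.strong_induction_on generalizing s H x with
  | _ n ih =>
    have e : blockSum c K H x =
        H [] • K x + cutSum (c x) (fun z => blockSum c K (shift z H) z) := by
      funext u
      exact blockSum_eq ..
    rw [blockSum_eq, e, conv_add_left, conv_smul_left, cutSum_conv]
    congr 1
    exact cutSum_congr (fun u _ => rfl) fun z u hu => ih _ (h ▸ hu) _ _ _ rfl

/-- `boxAux g f N F s` is `∑_π Cf_{s;π}(g) F(s|O) ∏_C Cf_{s|C}(f)`, summed over the non-crossing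
partitions of the positions of `s`, where `O` is the outer block of the Kreweras complement of `π`
and `C` runs over its other blocks, provided that `s` has length at most `N`. -/
def boxAux (g f : List β → ℂ) : ℕ → (List β → ℂ) → List β → ℂ
  -- The bound `0` gives a meaningful value only for the empty word; on other words the value is a
  -- default.
  | 0, F, _ => F []
  | _ + 1, F, [] => F []
  | N + 1, F, x :: s => blockSum (fun y => boxAux g f N (shift y f))
      (fun z => boxAux g f N (shift z F)) (shift x g) x s

/-- The sum that is described in `boxAux`. -/
def box (g f F : List β → ℂ) (s : List β) : ℂ := boxAux g f s.length F s

/-- All recursive calls concern subwords of the tail, so every bound that is at least the length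
gives the same value. -/
theorem boxAux_eq (g f : List β → ℂ) {N : ℕ} (F : List β → ℂ) {s : List β} (hs : s.length ≤ N) :
    boxAux g f N F s = box g f F s := by
  induction N using Nat.strong_induction_on generalizing F s with
  | _ N ih =>
    cases N with
    | zero => simp [box, List.length_eq_zero_iff.1 (Nat.le_zero.1 hs)]
    | succ N =>
      cases s with
      | nil => rfl
      | cons x s =>
        have hs' : s.length ≤ N := by simpa using hs
        rw [box, List.length_cons, boxAux, boxAux]
        refine blockSum_congr _ _ (fun z u hu => ?_) fun z u hu => ?_
        · rw [ih N (by omega) _ (hu.trans hs')]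
          rcases hs'.lt_or_eq with h | h
          · exact (ih s.length (by omega) _ hu).symm
          · rw [h, ih N (by omega) _ (by omega)]
        · rw [ih N (by omega) _ (hu.trans hs')]
          rcases hs'.lt_or_eq with h | h
          · exact (ih s.length (by omega) _ hu).symm
          · rw [h, ih N (by omega) _ (by omega)]

@[simp] theorem box_nil (g f F : List β → ℂ) : box g f F [] = F [] := rfl

theorem box_cons (g f F : List β → ℂ) (x : β) (s : List β) :
    box g f F (x :: s) = blockSum (fun y => box g f (shift y f))
      (fun z => box g f (shift z F)) (shift x g) x s := by
  rw [box, List.length_cons, boxAux]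
  exact blockSum_congr _ _ (fun z u hu => boxAux_eq _ _ _ hu) fun z u hu => boxAux_eq _ _ _ hu

theorem shift_box (g f F : List β → ℂ) (x : β) :
    shift x (box g f F) = blockSum (fun y => box g f (shift y f))
      (fun z => box g f (shift z F)) (shift x g) x := by
  funext s
  exact box_cons ..

/-- With trivial weights on the Kreweras complement, one gets the moment-cumulant formula. -/
theorem box_one (g : List β → ℂ) (s : List β) :
    box g (fun _ => 1) (fun _ => 1) s = fock g vac s := by
  -- With constant weights the gap functionals no longer depend on the preceding letter, and
  -- `blockSum_eq` becomes the recursion `fock_eq`.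
  have key : ∀ n, (∀ s : List β, s.length ≤ n →
      box g (fun _ => 1) (fun _ => 1) s = fock g vac s) → ∀ (H : List β → ℂ) (x : β) (s : List β),
      s.length ≤ n → blockSum (fun _ => box g (fun _ => 1) (fun _ => 1))
        (fun _ => box g (fun _ => 1) (fun _ => 1)) H x s = fock g H s := by
    intro n hn H x s hs
    induction h : s.length using Nat.strong_induction_on generalizing s H x with
    | _ m ih =>
      rw [blockSum_eq, fock_eq, hn s hs]
      congr 1
      exact cutSum_congr (fun u hu => hn u (by omega))
        fun z u hu => ih _ (h ▸ hu) _ _ _ (by omega) rfl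
  induction h : s.length using Nat.strong_induction_on generalizing s with
  | _ n ih =>
    cases s with
    | nil => rfl
    | cons x s =>
      rw [box_cons]
      have e : act g x (vac : List β → ℂ) = shift x g := by rw [act_eq, conv_vac]; simp
      rw [fock, e]
      exact key s.length (fun u hu => ih _ (by rw [← h]; simp; omega) u rfl) _ _ _ le_rfl

end Words

/-! ### Two families of letters -/

section TwoColours

variable {γ : Type*}

open Classical in
/-- Extension by zero of a functional on words to coloured words, living on the words of colour
`c`. -/
noncomputable def onColour (c : Bool) (H : List γ → ℂ) : List (Bool × γ) → ℂ :=
  fun s => if ∀ y ∈ s, y.1 = c then H (s.map Prod.snd) else 0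

@[simp] theorem onColour_nil (c : Bool) (H : List γ → ℂ) : onColour c H [] = H [] := by simp [onColour]

theorem shift_onColour (c : Bool) (i : γ) (H : List γ → ℂ) :
    shift (c, i) (onColour c H) = onColour c (shift i H) := by
  funext s
  simp only [onColour, shift_apply, List.forall_mem_cons, true_and, List.map_cons]

theorem shift_onColour_of_ne {c c' : Bool} (h : c' ≠ c) (i : γ) (H : List γ → ℂ) :
    shift (c', i) (onColour c H) = 0 := by
  funext s
  simp [onColour, h]

/-- The joint cumulants of two free families with cumulants `κ true` and `κ false`. -/
noncomputable def jointCumulant (κ : Bool → List γ → ℂ) : List (Bool × γ) → ℂ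
  | [] => 0
  | (c, i) :: s => onColour c (shift i (κ c)) s

theorem shift_jointCumulant (κ : Bool → List γ → ℂ) (c : Bool) (i : γ) :
    shift (c, i) (jointCumulant κ) = onColour c (shift i (κ c)) := rfl

/-! ### The intertwiner for products of free families -/

/-- `theta` for words of length at most `N`. -/
noncomputable def thetaAux (κ : Bool → List γ → ℂ) :
    ℕ → (List (Bool × γ) → ℂ) → List γ → ℂ
  | 0, G, _ => G []
  | _ + 1, G, [] => G []
  -- Transposed image of the word `x s`: the first summand keeps the creation operator of `(true,
  -- x)`; in the second, a block of colour `true` starting at `x` is closed and its last letter `z`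
  -- leaves an open letter `(false, z)`.
  | N + 1, G, x :: s =>
      thetaAux κ N (act (jointCumulant κ) (false, x) (shift (true, x) G)) s +
      blockSum (fun y => box (κ true) (κ false) (shift y (κ false)))
        (fun z => thetaAux κ N (shift (false, z) G)) (shift x (κ true)) x s

/-- The transpose of the map that intertwines the canonical operators with cumulants
`box (κ true) (κ false) (κ false)` with the products of the canonical operators with joint
cumulants `jointCumulant κ`. -/
noncomputable def theta (κ : Bool → List γ → ℂ) (G : List (Bool × γ) → ℂ) (s : List γ) : ℂ :=
  thetaAux κ s.length G s

theorem thetaAux_eq (κ : Bool → List γ → ℂ) {N : ℕ} (G : List (Bool × γ) → ℂ) {s : List γ}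
    (hs : s.length ≤ N) : thetaAux κ N G s = theta κ G s := by
  induction N using Nat.strong_induction_on generalizing G s with
  | _ N ih =>
    cases N with
    | zero => simp [theta, List.length_eq_zero_iff.1 (Nat.le_zero.1 hs)]
    | succ N =>
      cases s with
      | nil => rfl
      | cons x s =>
        have hs' : s.length ≤ N := by simpa using hs
        rw [theta, List.length_cons, thetaAux, thetaAux]
        congr 1
        · rw [ih N (by omega) _ hs', theta]
        refine blockSum_congr _ _ (fun z u hu => rfl) fun z u hu => ?_
        rw [ih N (by omega) _ (hu.trans hs')]
        rcases hs'.lt_or_eq with h | h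
        · exact (ih s.length (by omega) _ hu).symm
        · rw [h, ih N (by omega) _ (by omega)]

@[simp] theorem theta_nil (κ : Bool → List γ → ℂ) (G : List (Bool × γ) → ℂ) :
    theta κ G [] = G [] := rfl

theorem theta_cons (κ : Bool → List γ → ℂ) (G : List (Bool × γ) → ℂ) (x : γ) (s : List γ) :
    theta κ G (x :: s) = theta κ (act (jointCumulant κ) (false, x) (shift (true, x) G)) s +
      blockSum (fun y => box (κ true) (κ false) (shift y (κ false)))
        (fun z => theta κ (shift (false, z) G)) (shift x (κ true)) x s := by
  rw [theta, List.length_cons, thetaAux]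
  congr 1
  exact blockSum_congr _ _ (fun z u hu => rfl) fun z u hu => thetaAux_eq _ _ hu

theorem theta_add (κ : Bool → List γ → ℂ) (G G' : List (Bool × γ) → ℂ) (s : List γ) :
    theta κ (G + G') s = theta κ G s + theta κ G' s := by
  induction h : s.length using Nat.strong_induction_on generalizing s G G' with
  | _ n ih =>
    cases s with
    | nil => rfl
    | cons x s =>
      have hn : s.length < n := by rw [← h]; simp
      have hs (y : Bool × γ) : shift y (G + G') = shift y G + shift y G' := rfl
      rw [theta_cons, theta_cons, theta_cons, hs, act_add, ih _ hn _ _ _ rfl,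
        blockSum_congr _ _ (fun z u _ => rfl) fun z u hu => by
          rw [hs, ih u.length (by omega) _ _ _ rfl], blockSum_add]
      ring

theorem theta_smul (κ : Bool → List γ → ℂ) (a : ℂ) (G : List (Bool × γ) → ℂ) (s : List γ) :
    theta κ (a • G) s = a * theta κ G s := by
  induction h : s.length using Nat.strong_induction_on generalizing s G with
  | _ n ih =>
    cases s with
    | nil => rfl
    | cons x s =>
      have hn : s.length < n := by rw [← h]; simp
      have hs (y : Bool × γ) : shift y (a • G) = a • shift y G := rfl
      rw [theta_cons, theta_cons, hs, act_smul, ih _ hn _ _ rfl,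
        blockSum_congr _ _ (fun z u _ => rfl) fun z u hu => by
          rw [hs, ih u.length (by omega) _ _ rfl], blockSum_smul]
      ring

theorem theta_zero (κ : Bool → List γ → ℂ) (s : List γ) : theta κ 0 s = 0 := by
  simpa using theta_smul κ 0 0 s

/-- The image of a nonempty word has no vacuum component, since each of its summands begins with a
creation operator. -/
theorem theta_vac (κ : Bool → List γ → ℂ) : theta κ vac = vac := by
  funext s
  cases s with
  | nil => rfl
  | cons x s =>
    have h0 : act (jointCumulant κ) (false, x) 0 = 0 := by
      simpa using act_smul (jointCumulant κ) (false, x) 0 0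
    rw [theta_cons, shift_vac, h0, theta_zero,
      blockSum_congr (K' := fun z u => 0 * vac u) _ _ (fun z u _ => rfl) fun z u hu => by
        rw [shift_vac, theta_zero, zero_mul], blockSum_smul]
    simp

/-- A pending block of colour `false` is fed only by open letters `(false, z)`, which are the last
letters of closed blocks of colour `true`. They form the outer block of the complement, and this is
where `box` uses `F`. -/
theorem theta_conv_onColour_false (κ : Bool → List γ → ℂ) (F : List γ → ℂ)
    (G : List (Bool × γ) → ℂ) :
    theta κ (conv (onColour false F) G) = conv (box (κ true) (κ false) F) (theta κ G) := by
  funext s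
  induction h : s.length using Nat.strong_induction_on generalizing s F with
  | _ n ih =>
    cases s with
    | nil => simp [conv]
    | cons x s =>
      have hn : s.length < n := by rw [← h]; simp
      rw [theta_cons, shift_conv, shift_onColour_of_ne (by simp), conv_zero_left, add_zero, act_smul,
        theta_smul, onColour_nil, conv, box_nil, theta_cons, shift_box,
        ← blockSum_conv, mul_add, ← blockSum_smul, add_assoc, ← blockSum_add]
      congr 1
      refine blockSum_congr _ _ (fun z u _ => rfl) fun z u hu => ?_
      rw [shift_conv, theta_add, theta_smul, shift_onColour, ih u.length (by omega) _ _ rfl, onColour_nil]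

/-- Either the pending block of colour `true` is complete and `z` acts on `G`, or it takes `(true,
z)`. In the second case `(false, z)` is taken by `G`, if `z` completed the block, or opens a new
block of colour `false` in front. -/
theorem theta_conv_onColour_true_cons (κ : Bool → List γ → ℂ) (H : List γ → ℂ)
    (G : List (Bool × γ) → ℂ) (z : γ) (s : List γ) :
    theta κ (conv (onColour true H) G) (z :: s) = H [] * theta κ G (z :: s) +
      (H [z] * theta κ (shift (false, z) G) s +
        theta κ (conv (onColour false (shift z (κ false))) (conv (onColour true (shift z H)) G)) s) := by
  rw [theta_cons, theta_cons, shift_conv, act_add, theta_add, act_smul, theta_smul, onColour_nil,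
    shift_onColour, act_conv, theta_add, theta_smul, act_eq _ _ (onColour _ _), shift_onColour_of_ne (by simp), zero_add,
    shift_jointCumulant, conv_assoc, onColour_nil, shift_apply,
    blockSum_congr (K' := fun w u => H [] * theta κ (shift (false, w) G) u) _ _
      (fun z u _ => rfl) fun z u hu => by
        rw [shift_conv, shift_onColour_of_ne (by simp), conv_zero_left, add_zero, theta_smul,
          onColour_nil],
    blockSum_smul]
  ring

/-- The heart of the intertwining relation. `H` stands for what a block of colour `true`, whose
latest letter is `x`, still expects; on the right, the last `false` letter is left to `G` in the
first summand and lies in a closed block in the second. Expanding the new `false` block by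
`theta_conv_onColour_false` cuts `s` at the first letter `z` beyond the gap after `x`; there
`theta_conv_onColour_true_cons` reproduces the left side for `z` and `shift z H` on a shorter word.
-/
theorem theta_conv_conv (κ : Bool → List γ → ℂ) (H : List γ → ℂ)
    (G : List (Bool × γ) → ℂ) (x : γ) (s : List γ) :
    H [] * theta κ (shift (false, x) G) s +
        theta κ (conv (onColour false (shift x (κ false))) (conv (onColour true H) G)) s =
      blockSum (fun y => box (κ true) (κ false) (shift y (κ false)))
        (fun z => theta κ (shift (false, z) G)) H x s +
      conv (blockSum (fun y => box (κ true) (κ false) (shift y (κ false)))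
        (fun y => box (κ true) (κ false) (shift y (κ false))) H x) (theta κ G) s := by
  induction h : s.length using Nat.strong_induction_on generalizing s H x with
  | _ n ih =>
    set c : γ → List γ → ℂ := fun y => box (κ true) (κ false) (shift y (κ false)) with hc
    have e : blockSum c c H x =
        H [] • c x + cutSum (c x) (fun z => blockSum c c (shift z H) z) := by
      funext u
      exact blockSum_eq ..
    have e2 : cutSum (c x) (fun z => shift z (theta κ (conv (onColour true H) G))) s =
        cutSum (c x) (fun z u => H [] * shift z (theta κ G) u +
          (blockSum c (fun z => theta κ (shift (false, z) G)) (shift z H) z u +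
            conv (blockSum c c (shift z H) z) (theta κ G) u)) s := by
      refine cutSum_congr (fun u _ => rfl) fun z u hu => ?_
      rw [← ih u.length (h ▸ hu) _ _ _ rfl, shift_apply, theta_conv_onColour_true_cons]
      rfl
    rw [theta_conv_onColour_false, conv_eq_add_cutSum, e2, cutSum_add, cutSum_smul, cutSum_add, e,
      conv_add_left, conv_smul_left, cutSum_conv, blockSum_eq, conv_eq_add_cutSum (c x)]
    simp [conv]
    ring

/-- The creation part of `act` at `(true, x)` accounts for the first summand of `theta_cons`. The
cumulant part is the left side of `theta_conv_conv` with `H` equal to `shift x (κ true)`, which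
supplies the other summand and the cumulants `box`. -/
theorem theta_act_act (κ : Bool → List γ → ℂ) (G : List (Bool × γ) → ℂ) (x : γ) :
    theta κ (act (jointCumulant κ) (false, x) (act (jointCumulant κ) (true, x) G)) =
      act (box (κ true) (κ false) (κ false)) x (theta κ G) := by
  funext s
  rw [act_eq _ (true, x), act_add, theta_add, shift_jointCumulant, act_conv, theta_add,
    act_eq _ _ (onColour true _), shift_onColour_of_ne (by simp), zero_add, shift_jointCumulant,
    conv_assoc, theta_smul, onColour_nil, theta_conv_conv, act, theta_cons, shift_box]
  ring

/-- The word `(true, x₁) (false, x₁) (true, x₂) (false, x₂) ⋯`. -/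
def alternate (w : List γ) : List (Bool × γ) := w.flatMap fun x => [(true, x), (false, x)]

/-- The moments of the products of two free families are the moments whose cumulants are given by
the boxed convolution. -/
theorem fock_alternate (κ : Bool → List γ → ℂ) (w : List γ) :
    fock (jointCumulant κ) vac (alternate w) =
      fock (box (κ true) (κ false) (κ false)) vac w := by
  have key : ∀ G, fock (jointCumulant κ) G (alternate w) =
      fock (box (κ true) (κ false) (κ false)) (theta κ G) w := by
    induction w with
    | nil => intro G; rfl
    | cons x w ih =>
      intro G
      have : alternate (x :: w) = (true, x) :: (false, x) :: alternate w := rfl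
      rw [this, fock, fock, ih, theta_act_act, fock]
  rw [key, theta_vac]

end TwoColours

/-! ### Vacuum expectation on the free algebra -/

section FockRep

variable {β : Type*}

/-- `act κ x` as a linear map. -/
def actLinear (κ : List β → ℂ) (x : β) : Module.End ℂ (List β → ℂ) where
  toFun := act κ x
  map_add' := act_add κ x
  map_smul' := act_smul κ x

/-- The right action of non-commutative polynomials on functionals on words. -/
noncomputable def fockRep (κ : List β → ℂ) :
    FreeAlgebra ℂ β →ₐ[ℂ] (Module.End ℂ (List β → ℂ))ᵐᵒᵖ :=
  FreeAlgebra.lift ℂ fun x => MulOpposite.op (actLinear κ x)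

/-- The functional `G` acted upon by the polynomial `P`. -/
noncomputable def rightAct (κ : List β → ℂ) (P : FreeAlgebra ℂ β) (G : List β → ℂ) :
    List β → ℂ :=
  (fockRep κ P).unop G

theorem rightAct_mul (κ : List β → ℂ) (P Q : FreeAlgebra ℂ β) (G : List β → ℂ) :
    rightAct κ (P * Q) G = rightAct κ Q (rightAct κ P G) := by
  simp [rightAct]

theorem rightAct_add (κ : List β → ℂ) (P Q : FreeAlgebra ℂ β) (G : List β → ℂ) :
    rightAct κ (P + Q) G = rightAct κ P G + rightAct κ Q G := by
  simp [rightAct]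

theorem rightAct_algebraMap (κ : List β → ℂ) (r : ℂ) (G : List β → ℂ) :
    rightAct κ (algebraMap ℂ _ r) G = r • G := by
  simp only [rightAct, AlgHom.commutes]
  rfl

theorem rightAct_ι (κ : List β → ℂ) (x : β) (G : List β → ℂ) :
    rightAct κ (FreeAlgebra.ι ℂ x) G = act κ x G := by
  simp [rightAct, fockRep, actLinear]

theorem rightAct_smul (κ : List β → ℂ) (P : FreeAlgebra ℂ β) (r : ℂ) (G : List β → ℂ) :
    rightAct κ P (r • G) = r • rightAct κ P G := by
  simp [rightAct]

/-- The vacuum expectation on non-commutative polynomials. -/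
noncomputable def vacuumExp (κ : List β → ℂ) : FreeAlgebra ℂ β →ₗ[ℂ] ℂ where
  toFun P := rightAct κ P vac []
  map_add' P Q := by simp [rightAct_add]
  map_smul' r P := by simp [rightAct]

theorem vacuumExp_apply (κ : List β → ℂ) (P : FreeAlgebra ℂ β) :
    vacuumExp κ P = rightAct κ P vac [] := rfl

theorem vacuumExp_one (κ : List β → ℂ) : vacuumExp κ 1 = 1 := by
  simp [vacuumExp_apply, rightAct]

theorem vacuumExp_prod_ι (κ : List β → ℂ) (w : List β) :
    vacuumExp κ (w.map (FreeAlgebra.ι ℂ)).prod = fock κ vac w := by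
  have key : ∀ G, rightAct κ (w.map (FreeAlgebra.ι ℂ)).prod G [] = fock κ G w := by
    induction w with
    | nil => intro G; simp [rightAct, fock]
    | cons x w ih => intro G; simp [rightAct_mul, ih, rightAct_ι, fock]
  exact key vac

/-- A left ideal that contains `1` is everything. -/
theorem mem_of_ι_mul_mem (W : Submodule ℂ (FreeAlgebra ℂ β)) (h1 : 1 ∈ W)
    (h : ∀ x, ∀ Q ∈ W, FreeAlgebra.ι ℂ x * Q ∈ W) (P : FreeAlgebra ℂ β) : P ∈ W := by
  have key : ∀ Q ∈ W, P * Q ∈ W := by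
    refine FreeAlgebra.induction ℂ β (motive := fun P => ∀ Q ∈ W, P * Q ∈ W) ?_ ?_ ?_ ?_ P
    · intro r Q hQ
      rw [← Algebra.smul_def]
      exact W.smul_mem r hQ
    · exact h
    · intro P P' hP hP' Q hQ
      rw [mul_assoc]
      exact hP _ (hP' _ hQ)
    · intro P P' hP hP' Q hQ
      rw [add_mul]
      exact W.add_mem (hP _ hQ) (hP' _ hQ)
  simpa using key 1 h1

/-- Linear functionals that agree on all monomials are equal. -/
theorem linearMap_eq_of_prod_ι (φ ψ : FreeAlgebra ℂ β →ₗ[ℂ] ℂ)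
    (h : ∀ w : List β, φ (w.map (FreeAlgebra.ι ℂ)).prod = ψ (w.map (FreeAlgebra.ι ℂ)).prod) :
    φ = ψ := by
  have hspan : ∀ P, P ∈ Submodule.span ℂ
      (Set.range fun w : List β => (w.map (FreeAlgebra.ι ℂ)).prod) := by
    refine mem_of_ι_mul_mem _ (Submodule.subset_span ⟨[], rfl⟩) fun x Q hQ => ?_
    induction hQ using Submodule.span_induction with
    | mem Q hQ =>
      obtain ⟨w, rfl⟩ := hQ
      exact Submodule.subset_span ⟨x :: w, by simp⟩
    | zero => simp
    | add P Q _ _ hP hQ => rw [mul_add]; exact Submodule.add_mem _ hP hQ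
    | smul r P _ hP => rw [mul_smul_comm]; exact Submodule.smul_mem _ _ hP
  ext P
  induction hspan P using Submodule.span_induction with
  | mem Q hQ =>
    obtain ⟨w, rfl⟩ := hQ
    exact h w
  | zero => simp
  | add P Q _ _ hP hQ => simp [hP, hQ]
  | smul r P _ hP => simp [hP]

end FockRep

/-! ### Freeness of the two colours and uniqueness of joint moments -/

section Freeness

variable {γ : Type*}

/-- The inclusion of the polynomials in the letters of one colour. -/
noncomputable def colour (c : Bool) : FreeAlgebra ℂ γ →ₐ[ℂ] FreeAlgebra ℂ (Bool × γ) :=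
  FreeAlgebra.lift ℂ fun i => FreeAlgebra.ι ℂ (c, i)

/-- The words that do not start with a letter of colour `c`. -/
def NotHead (c : Bool) (s : List (Bool × γ)) : Prop := ∀ i t, s ≠ (c, i) :: t

/-- A prefix of colour `c` cannot extend into `s`, so only `r` gets cut. -/
theorem conv_onColour (c : Bool) (H : List γ → ℂ) (G : List (Bool × γ) → ℂ)
    {s : List (Bool × γ)} (hs : NotHead c s) (r : List γ) :
    conv (onColour c H) G (r.map (Prod.mk c) ++ s) =
      conv H (fun u => G (u.map (Prod.mk c) ++ s)) r := by
  induction r generalizing H with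
  | nil =>
    cases s with
    | nil => simp [conv]
    | cons y s =>
      have hy : y.1 ≠ c := fun h => hs y.2 s (by rw [← h])
      obtain ⟨d, i⟩ := y
      simp [conv, shift_onColour_of_ne hy]
  | cons i r ih => simp [conv, shift_onColour, ih]

/-- A polynomial of colour `c` affects only the maximal initial run of that colour; the remaining
word `s` is a spectator. -/
theorem rightAct_colour (κ : Bool → List γ → ℂ) (c : Bool) (p : FreeAlgebra ℂ γ)
    {s : List (Bool × γ)} (hs : NotHead c s) (G : List (Bool × γ) → ℂ) (r : List γ) :
    rightAct (jointCumulant κ) (colour c p) G (r.map (Prod.mk c) ++ s) =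
      rightAct (κ c) p (fun u => G (u.map (Prod.mk c) ++ s)) r := by
  refine FreeAlgebra.induction ℂ γ (motive := fun p => ∀ G r,
    rightAct (jointCumulant κ) (colour c p) G (r.map (Prod.mk c) ++ s) =
      rightAct (κ c) p (fun u => G (u.map (Prod.mk c) ++ s)) r) ?_ ?_ ?_ ?_ p G r
  · intro a G r
    rw [AlgHom.commutes, rightAct_algebraMap, rightAct_algebraMap]
    rfl
  · intro i G r
    rw [colour, FreeAlgebra.lift_ι_apply, rightAct_ι, rightAct_ι, act, act, shift_jointCumulant,
      conv_onColour _ _ _ hs]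
    rfl
  · intro p q hp hq G r
    rw [map_mul, rightAct_mul, rightAct_mul, hq]
    congr 1
    funext u
    exact hp G u
  · intro p q hp hq G r
    rw [map_add, rightAct_add, rightAct_add, Pi.add_apply, Pi.add_apply, hp, hq]

/-- On words `r s` with `r` of colour `c`, such a `G` is the multiple `G s • vac`, and `p` applied
to `vac` has its vacuum expectation as value at the empty word. -/
theorem rightAct_colour_of_vanish (κ : Bool → List γ → ℂ) (c : Bool) (p : FreeAlgebra ℂ γ)
    {s : List (Bool × γ)} (hs : NotHead c s) (G : List (Bool × γ) → ℂ)
    (hG : ∀ i t, G ((c, i) :: t) = 0) :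
    rightAct (jointCumulant κ) (colour c p) G s = vacuumExp (κ c) p * G s := by
  have h := rightAct_colour κ c p hs G []
  have e : (fun u : List γ => G (u.map (Prod.mk c) ++ s)) = G s • vac := by
    funext u
    cases u <;> simp [hG]
  rw [e, rightAct_smul] at h
  simpa [vacuumExp_apply, mul_comm] using h

/-- Alternating products of centered polynomials, whose first factor has colour `c`. -/
inductive Alternating (κ : Bool → List γ → ℂ) : Bool → FreeAlgebra ℂ (Bool × γ) → Prop
  | single (c : Bool) (p : FreeAlgebra ℂ γ) (hp : vacuumExp (κ c) p = 0) :
      Alternating κ c (colour c p)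
  | cons (c : Bool) (p : FreeAlgebra ℂ γ) (hp : vacuumExp (κ c) p = 0)
      (Q : FreeAlgebra ℂ (Bool × γ)) (hQ : Alternating κ (!c) Q) :
      Alternating κ c (colour c p * Q)

/-- Invariant: before a factor of colour `c` acts, the functional vanishes on words that start with
`c`. A centred factor then makes it vanish on words that start with the other colour, and on the
empty word. -/
theorem Alternating.vacuumExp_eq_zero {κ : Bool → List γ → ℂ} {c : Bool}
    {Q : FreeAlgebra ℂ (Bool × γ)} (h : Alternating κ c Q) :
    vacuumExp (jointCumulant κ) Q = 0 := by
  have key : ∀ G : List (Bool × γ) → ℂ, (∀ i t, G ((c, i) :: t) = 0) →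
      rightAct (jointCumulant κ) Q G [] = 0 := by
    induction h with
    | single c p hp =>
      intro G hG
      rw [rightAct_colour_of_vanish κ c p (by intro i t; simp) G hG, hp, zero_mul]
    | cons c p hp Q _ ih =>
      intro G hG
      rw [rightAct_mul]
      refine ih _ fun i t => ?_
      rw [rightAct_colour_of_vanish κ c p (by intro i t; simp) G hG, hp, zero_mul]
  exact key vac fun _ _ => rfl

/-- The span is stable under left multiplication by a letter: a letter of the colour of the first
factor is merged into it, any other letter becomes a new factor, and the first factor is then
centred by splitting off its expectation. -/
theorem span_alternating (κ : Bool → List γ → ℂ) (P : FreeAlgebra ℂ (Bool × γ)) :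
    P ∈ Submodule.span ℂ (insert 1 {Q | ∃ c, Alternating κ c Q}) := by
  set W := Submodule.span ℂ (insert 1 {Q | ∃ c, Alternating κ c Q}) with hW
  have h1 : (1 : FreeAlgebra ℂ (Bool × γ)) ∈ W := Submodule.subset_span (Or.inl rfl)
  have ha : ∀ {c Q}, Alternating κ c Q → Q ∈ W :=
    fun h => Submodule.subset_span (Or.inr ⟨_, h⟩)
  have hcenter (c : Bool) (p : FreeAlgebra ℂ γ) :
      vacuumExp (κ c) (p - algebraMap ℂ _ (vacuumExp (κ c) p)) = 0 := by
    rw [map_sub, Algebra.algebraMap_eq_smul_one, map_smul, vacuumExp_one]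
    simp
  have hsplit (c : Bool) (p : FreeAlgebra ℂ γ) : colour c p =
      colour c (p - algebraMap ℂ _ (vacuumExp (κ c) p)) +
        algebraMap ℂ _ (vacuumExp (κ c) p) := by
    rw [map_sub, AlgHom.commutes, sub_add_cancel]
  have hc1 (c : Bool) (p : FreeAlgebra ℂ γ) : colour c p ∈ W := by
    rw [hsplit]
    refine W.add_mem (ha (.single c _ (hcenter c p))) ?_
    rw [Algebra.algebraMap_eq_smul_one]
    exact W.smul_mem _ h1
  have hc2 (c : Bool) (p : FreeAlgebra ℂ γ) {Q} (hQ : Alternating κ (!c) Q) :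
      colour c p * Q ∈ W := by
    rw [hsplit, add_mul, ← Algebra.smul_def]
    exact W.add_mem (ha (.cons c _ (hcenter c p) Q hQ)) (W.smul_mem _ (ha hQ))
  have hι (c : Bool) (i : γ) : FreeAlgebra.ι ℂ (c, i) = colour c (FreeAlgebra.ι ℂ i) := by
    simp [colour]
  refine mem_of_ι_mul_mem W h1 (fun x Q hQ => ?_) P
  obtain ⟨c, i⟩ := x
  induction hQ using Submodule.span_induction with
  | mem Q hQ =>
    rcases hQ with rfl | ⟨d, hQ⟩
    · rw [mul_one, hι]
      exact hc1 c _
    · rw [hι]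
      by_cases hd : d = !c
      · subst hd
        exact hc2 c _ hQ
      · have hd : d = c := by cases c <;> cases d <;> simp_all
        subst hd
        cases hQ with
        | single _ p hp =>
          rw [← map_mul]
          exact hc1 d _
        | cons _ p hp Q hQ =>
          rw [← mul_assoc, ← map_mul]
          exact hc2 d _ hQ
  | zero => simp
  | add P Q _ _ hP hQ => rw [mul_add]; exact W.add_mem hP hQ
  | smul r P _ hP => rw [mul_smul_comm]; exact W.smul_mem _ hP

variable {A : Type} [Ring A] [Algebra ℂ A]

theorem Alternating.eq_zero_of_freelyIndependent {κ : Bool → List γ → ℂ}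
    (φ : UnitalFunctional A) (a : Bool → γ → A) (𝒜 : Bool → Subalgebra ℂ A)
    (hmem : ∀ c i, a c i ∈ 𝒜 c) (hfree : FreelyIndependent φ 𝒜)
    (hκ : ∀ c p, φ (FreeAlgebra.lift ℂ (a c) p) = vacuumExp (κ c) p)
    {c : Bool} {Q : FreeAlgebra ℂ (Bool × γ)} (h : Alternating κ c Q) :
    φ (FreeAlgebra.lift ℂ (fun y : Bool × γ => a y.1 y.2) Q) = 0 := by
  have hlift (c : Bool) (p : FreeAlgebra ℂ γ) :
      FreeAlgebra.lift ℂ (fun y : Bool × γ => a y.1 y.2) (colour c p) =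
        FreeAlgebra.lift ℂ (a c) p := by
    have : (FreeAlgebra.lift ℂ (fun y : Bool × γ => a y.1 y.2)).comp (colour c) =
        FreeAlgebra.lift ℂ (a c) := by
      ext i
      simp [colour]
    rw [← this]
    rfl
  have hm (c : Bool) (p : FreeAlgebra ℂ γ) : FreeAlgebra.lift ℂ (a c) p ∈ 𝒜 c := by
    have h1 : FreeAlgebra.lift ℂ (a c) p ∈ Algebra.adjoin ℂ (Set.range (a c)) := by
      rw [Algebra.adjoin_range_eq_range_freeAlgebra_lift]
      exact ⟨p, rfl⟩
    refine Algebra.adjoin_le ?_ h1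
    rintro _ ⟨i, rfl⟩
    exact hmem c i
  -- Recording `d 0 = c` lets the induction check alternation when a factor is put in front.
  have key : ∃ (n : ℕ) (d : Fin (n + 1) → Bool) (x : Fin (n + 1) → A), d 0 = c ∧
      (∀ j : Fin n, d j.castSucc ≠ d j.succ) ∧ (∀ j, x j ∈ 𝒜 (d j)) ∧ (∀ j, φ (x j) = 0) ∧
      (List.ofFn x).prod = FreeAlgebra.lift ℂ (fun y : Bool × γ => a y.1 y.2) Q := by
    induction h with
    | single c p hp =>
      exact ⟨0, fun _ => c, fun _ => FreeAlgebra.lift ℂ (a c) p, rfl, fun j => j.elim0,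
        fun _ => hm c p, fun _ => (hκ c p).trans hp, by simp [hlift]⟩
    | cons c p hp Q _ ih =>
      obtain ⟨n, d, x, hd0, hd, hx, hφ, hprod⟩ := ih
      refine ⟨n + 1, Fin.cons c d, Fin.cons (FreeAlgebra.lift ℂ (a c) p) x, rfl, fun j => ?_,
        fun j => ?_, fun j => ?_, ?_⟩
      · refine Fin.cases ?_ (fun j => ?_) j
        · simp [hd0]
        · simpa using hd j
      · refine Fin.cases ?_ (fun j => ?_) j
        · exact hm c p
        · exact hx j
      · refine Fin.cases ?_ (fun j => ?_) j
        · exact (hκ c p).trans hp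
        · exact hφ j
      · rw [List.ofFn_succ, List.prod_cons, map_mul, hlift, ← hprod]
        rfl
  obtain ⟨n, d, x, -, hd, hx, hφ, hprod⟩ := key
  rw [← hprod]
  exact hfree n d x hd hx hφ

/-- The joint moments of free families. -/
theorem eq_vacuumExp_of_freelyIndependent {κ : Bool → List γ → ℂ}
    (φ : UnitalFunctional A) (a : Bool → γ → A) (𝒜 : Bool → Subalgebra ℂ A)
    (hmem : ∀ c i, a c i ∈ 𝒜 c) (hfree : FreelyIndependent φ 𝒜)
    (hκ : ∀ c p, φ (FreeAlgebra.lift ℂ (a c) p) = vacuumExp (κ c) p)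
    (P : FreeAlgebra ℂ (Bool × γ)) :
    φ (FreeAlgebra.lift ℂ (fun y : Bool × γ => a y.1 y.2) P) =
      vacuumExp (jointCumulant κ) P := by
  induction span_alternating κ P using Submodule.span_induction with
  | mem Q hQ =>
    rcases hQ with rfl | ⟨d, hQ⟩
    · rw [map_one, vacuumExp_one]
      exact φ.map_one
    · rw [hQ.vacuumExp_eq_zero]
      exact hQ.eq_zero_of_freelyIndependent φ a 𝒜 hmem hfree hκ
  | zero => simp
  | add P Q _ _ hP hQ => simp [hP, hQ]
  | smul r P _ hP => simp [hP]

end Freeness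

/-- The moments of a free multiplicative convolution, in terms of series that determine the moments
of the factors. -/
theorem IsFreeMulConv.apply_monomial {k : ℕ} {μ ν ρ : Distribution k}
    (h : IsFreeMulConv μ ν ρ) {f g : List (Fin k) → ℂ}
    (hf : ∀ w, μ (monomial w) = fock f vac w) (hg : ∀ w, ν (monomial w) = fock g vac w)
    (w : List (Fin k)) : ρ (monomial w) = fock (box f g g) vac w := by
  obtain ⟨A, _, _, φ, a, b, hfree, rfl, rfl, rfl⟩ := h
  have hκ : ∀ c p, φ (FreeAlgebra.lift ℂ (cond c a b) p) = vacuumExp (cond c f g) p := by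
    intro c p
    cases c
    · exact LinearMap.congr_fun (linearMap_eq_of_prod_ι
        (φ.toLinearMap ∘ₗ (FreeAlgebra.lift ℂ b).toLinearMap) (vacuumExp g)
        fun w => (hg w).trans (vacuumExp_prod_ι g w).symm) p
    · exact LinearMap.congr_fun (linearMap_eq_of_prod_ι
        (φ.toLinearMap ∘ₗ (FreeAlgebra.lift ℂ a).toLinearMap) (vacuumExp f)
        fun w => (hf w).trans (vacuumExp_prod_ι f w).symm) p
  have hmem : ∀ (c : Bool) (i : Fin k), (cond c a b : Fin k → A) i ∈
      Algebra.adjoin ℂ (cond c (Set.range a) (Set.range b)) := by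
    intro c i
    cases c
    · exact Algebra.subset_adjoin ⟨i, rfl⟩
    · exact Algebra.subset_adjoin ⟨i, rfl⟩
  have key := eq_vacuumExp_of_freelyIndependent (κ := fun c => cond c f g) φ
    (fun c => cond c a b) _ hmem hfree hκ ((alternate w).map (FreeAlgebra.ι ℂ)).prod
  rw [vacuumExp_prod_ι, fock_alternate] at key
  rw [← show _ = fock (box f g g) vac w from key]
  change φ (FreeAlgebra.lift ℂ (fun i => a i * b i) (monomial w)) = _
  congr 1
  rw [monomial, map_list_prod, map_list_prod, List.map_map, List.map_map]
  clear key
  induction w with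
  | nil => rfl
  | cons i w ih =>
    have : alternate (i :: w) = (true, i) :: (false, i) :: alternate w := rfl
    rw [this]
    simp only [List.map_cons, List.prod_cons, ih]
    simp [mul_assoc]

/-! ### Non-crossing partitions of finite subsets of a linear order -/

section Saturated

variable {α : Type*}

/-- The set where `p` holds is a union of blocks of `P`. -/
def Saturated (P : Finset (Finset α)) (p : α → Prop) : Prop :=
  ∀ B ∈ P, ∀ a ∈ B, ∀ b ∈ B, p a → p b

theorem Saturated.iff {P : Finset (Finset α)} {p : α → Prop} (h : Saturated P p) {B : Finset α}
    (hB : B ∈ P) {a b : α} (ha : a ∈ B) (hb : b ∈ B) : p a ↔ p b :=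
  ⟨h B hB a ha b hb, h B hB b hb a ha⟩

theorem saturated_congr {S : Finset α} {P : Finset (Finset α)} (hP : ∀ B ∈ P, B ⊆ S)
    {p q : α → Prop} (h : ∀ a ∈ S, p a ↔ q a) : Saturated P p ↔ Saturated P q := by
  unfold Saturated
  constructor
  · intro H B hB a ha b hb hq
    exact (h b (hP B hB hb)).1 (H B hB a ha b hb ((h a (hP B hB ha)).2 hq))
  · intro H B hB a ha b hb hq
    exact (h b (hP B hB hb)).2 (H B hB a ha b hb ((h a (hP B hB ha)).1 hq))

theorem saturated_not {P : Finset (Finset α)} {p : α → Prop} :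
    Saturated P (fun a => ¬ p a) ↔ Saturated P p := by
  constructor
  · intro H B hB a ha b hb hp
    by_contra hn
    exact H B hB b hb a ha hn hp
  · intro H B hB a ha b hb hp hn
    exact hp (H B hB b hb a ha hn)

theorem saturated_of_forall {S : Finset α} {P : Finset (Finset α)} (hP : ∀ B ∈ P, B ⊆ S)
    {p : α → Prop} (h : ∀ a ∈ S, p a) : Saturated P p :=
  fun B hB _ _ b hb _ => h b (hP B hB hb)

end Saturated

section SetPartitions

variable {α : Type*} [LinearOrder α]

/-- `P` is the set of blocks of a non-crossing partition of `S`. -/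
structure IsNCP (S : Finset α) (P : Finset (Finset α)) : Prop where
  nonempty : ∀ B ∈ P, B.Nonempty
  subset : ∀ B ∈ P, B ⊆ S
  cover : ∀ x ∈ S, ∃ B ∈ P, x ∈ B
  eq_of_mem : ∀ B ∈ P, ∀ C ∈ P, ∀ x, x ∈ B → x ∈ C → B = C
  noncrossing : ∀ B ∈ P, ∀ C ∈ P, ∀ a b c d, a < b → b < c → c < d →
    a ∈ B → b ∈ C → c ∈ B → d ∈ C → B = C

open Classical in
/-- The non-crossing partitions of `S`. -/
noncomputable def ncp (S : Finset α) : Finset (Finset (Finset α)) :=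
  S.powerset.powerset.filter (IsNCP S)

theorem mem_ncp {S : Finset α} {P : Finset (Finset α)} : P ∈ ncp S ↔ IsNCP S P := by
  simp only [ncp, Finset.mem_filter, Finset.mem_powerset, and_iff_right_iff_imp]
  intro h B hB
  exact Finset.mem_powerset.2 (h.subset B hB)

/-- `x` and `y` are in one block of the Kreweras complement of `P`: the half-open interval between
`x` and `y` is a union of blocks of `P`. -/
def KrewerasRel (P : Finset (Finset α)) (x y : α) : Prop :=
  Saturated P fun a => (a ≤ x ↔ a ≤ y)

open Classical in
/-- The block of `x` in the Kreweras complement of `P`. -/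
noncomputable def krewerasBlock (S : Finset α) (P : Finset (Finset α)) (x : α) : Finset α :=
  S.filter (KrewerasRel P x)

open Classical in
/-- The outer block of the Kreweras complement of `P`. -/
noncomputable def outerBlock (S : Finset α) (P : Finset (Finset α)) : Finset α :=
  S.filter fun y => Saturated P (· ≤ y)

open Classical in
/-- The product of `f` over the blocks of the Kreweras complement of `P`, other than the outer
block. -/
noncomputable def innerWeight (f : Finset α → ℂ) (S : Finset α) (P : Finset (Finset α)) : ℂ :=
  ∏ z ∈ S, if z ∈ outerBlock S P ∨ ∃ z' ∈ S, z' < z ∧ KrewerasRel P z' z then 1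
    else f (krewerasBlock S P z)

/-- The sum over the non-crossing partitions of `S`, with weights `γ` for the blocks, and `F` and
`f` for the outer and the inner blocks of the Kreweras complement. -/
noncomputable def ncpSum (γ f F : Finset α → ℂ) (S : Finset α) : ℂ :=
  ∑ P ∈ ncp S, (∏ B ∈ P, γ B) * (F (outerBlock S P) * innerWeight f S P)

theorem outerBlock_subset (S : Finset α) (P : Finset (Finset α)) : outerBlock S P ⊆ S := by
  classical exact Finset.filter_subset _ _

theorem krewerasBlock_subset (S : Finset α) (P : Finset (Finset α)) (x : α) :
    krewerasBlock S P x ⊆ S := by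
  classical exact Finset.filter_subset _ _

theorem mem_outerBlock {S : Finset α} {P : Finset (Finset α)} {y : α} :
    y ∈ outerBlock S P ↔ y ∈ S ∧ Saturated P (· ≤ y) := by
  simp [outerBlock]

theorem mem_krewerasBlock {S : Finset α} {P : Finset (Finset α)} {x y : α} :
    y ∈ krewerasBlock S P x ↔ y ∈ S ∧ KrewerasRel P x y := by
  simp [krewerasBlock]

theorem ncpSum_congr {γ γ' f f' F F' : Finset α → ℂ} {S : Finset α}
    (hγ : ∀ B ⊆ S, γ B = γ' B) (hf : ∀ B ⊆ S, f B = f' B) (hF : ∀ B ⊆ S, F B = F' B) :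
    ncpSum γ f F S = ncpSum γ' f' F' S := by
  refine Finset.sum_congr rfl fun P hP => ?_
  rw [hF _ (outerBlock_subset S P)]
  congr 1
  · exact Finset.prod_congr rfl fun B hB => hγ B ((mem_ncp.1 hP).subset B hB)
  · congr 1
    refine Finset.prod_congr rfl fun z _ => ?_
    rw [hf _ (krewerasBlock_subset S P z)]

theorem ncp_empty : ncp (∅ : Finset α) = {∅} := by
  ext P
  rw [mem_ncp, Finset.mem_singleton]
  constructor
  · intro h
    refine Finset.eq_empty_of_forall_notMem fun B hB => ?_
    exact (h.nonempty B hB).ne_empty (Finset.subset_empty.1 (h.subset B hB))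
  · rintro rfl
    constructor <;> simp

theorem ncpSum_empty (γ f F : Finset α → ℂ) : ncpSum γ f F ∅ = F ∅ := by
  simp [ncpSum, ncp_empty, outerBlock, innerWeight]

/-! #### Adding a new least element as a singleton -/

theorem saturated_insert_singleton {P : Finset (Finset α)} {x : α} {p : α → Prop} :
    Saturated (insert {x} P) p ↔ Saturated P p := by
  constructor
  · intro h B hB
    exact h B (Finset.mem_insert_of_mem hB)
  · intro h B hB a ha b hb
    rcases Finset.mem_insert.1 hB with rfl | hB
    · rw [Finset.mem_singleton] at ha hb
      rw [ha, hb]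
      exact id
    · exact h B hB a ha b hb

theorem IsNCP.insert_singleton {S : Finset α} {P : Finset (Finset α)} {x : α} (hx : x ∉ S)
    (hP : IsNCP S P) : IsNCP (insert x S) (insert {x} P) := by
  have hxB : ∀ B ∈ P, x ∉ B := fun B hB h => hx (hP.subset B hB h)
  refine ⟨?_, ?_, ?_, ?_, ?_⟩
  · intro B hB
    rcases Finset.mem_insert.1 hB with rfl | hB
    · simp
    · exact hP.nonempty B hB
  · intro B hB
    rcases Finset.mem_insert.1 hB with rfl | hB
    · simp
    · exact (hP.subset B hB).trans (Finset.subset_insert _ _)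
  · intro y hy
    rcases Finset.mem_insert.1 hy with rfl | hy
    · exact ⟨{y}, by simp, by simp⟩
    · obtain ⟨B, hB, hyB⟩ := hP.cover y hy
      exact ⟨B, Finset.mem_insert_of_mem hB, hyB⟩
  · intro B hB C hC y hyB hyC
    rcases Finset.mem_insert.1 hB with rfl | hB <;> rcases Finset.mem_insert.1 hC with rfl | hC
    · rfl
    · rw [Finset.mem_singleton] at hyB
      exact absurd (hyB ▸ hyC) (hxB C hC)
    · rw [Finset.mem_singleton] at hyC
      exact absurd (hyC ▸ hyB) (hxB B hB)
    · exact hP.eq_of_mem B hB C hC y hyB hyC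
  · intro B hB C hC a b c d hab hbc hcd ha hb hc hd
    rcases Finset.mem_insert.1 hB with rfl | hB
    · rw [Finset.mem_singleton] at ha hc
      exact absurd (hab.trans hbc) (by rw [ha, hc]; exact lt_irrefl _)
    rcases Finset.mem_insert.1 hC with rfl | hC
    · rw [Finset.mem_singleton] at hb hd
      exact absurd (hbc.trans hcd) (by rw [hb, hd]; exact lt_irrefl _)
    exact hP.noncrossing B hB C hC a b c d hab hbc hcd ha hb hc hd

theorem IsNCP.erase_singleton {S : Finset α} {P : Finset (Finset α)} {x : α} (hx : x ∉ S)
    (hP : IsNCP (insert x S) P) (hxP : {x} ∈ P) : IsNCP S (P.erase {x}) := by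
  have hxB : ∀ B ∈ P.erase {x}, x ∉ B := fun B hB h =>
    Finset.ne_of_mem_erase hB (hP.eq_of_mem B (Finset.mem_of_mem_erase hB) _ hxP x h (by simp))
  refine ⟨?_, ?_, ?_, ?_, ?_⟩
  · exact fun B hB => hP.nonempty B (Finset.mem_of_mem_erase hB)
  · exact fun B hB => (Finset.subset_insert_iff_of_notMem (hxB B hB)).1
      (hP.subset B (Finset.mem_of_mem_erase hB))
  · intro y hy
    obtain ⟨B, hB, hyB⟩ := hP.cover y (Finset.mem_insert_of_mem hy)
    refine ⟨B, Finset.mem_erase.2 ⟨?_, hB⟩, hyB⟩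
    rintro rfl
    rw [Finset.mem_singleton] at hyB
    exact hx (hyB ▸ hy)
  · exact fun B hB C hC => hP.eq_of_mem B (Finset.mem_of_mem_erase hB) C
      (Finset.mem_of_mem_erase hC)
  · exact fun B hB C hC => hP.noncrossing B (Finset.mem_of_mem_erase hB) C
      (Finset.mem_of_mem_erase hC)

theorem outerBlock_insert_singleton {S : Finset α} {P : Finset (Finset α)} {x : α}
    (hx : ∀ z ∈ S, x < z) (hP : IsNCP S P) :
    outerBlock (insert x S) (insert {x} P) = insert x (outerBlock S P) := by
  ext z
  rw [mem_outerBlock, saturated_insert_singleton, Finset.mem_insert, Finset.mem_insert,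
    mem_outerBlock]
  constructor
  · rintro ⟨rfl | hz, h⟩
    · exact Or.inl rfl
    · exact Or.inr ⟨hz, h⟩
  · rintro (rfl | ⟨hz, h⟩)
    · refine ⟨Or.inl rfl, saturated_not.1 (saturated_of_forall hP.subset ?_)⟩
      exact fun a ha => (hx a ha).not_ge
    · exact ⟨Or.inr hz, h⟩

/-- With `x` below `S`, the half-open interval from `x` to `z` meets `S` in the initial segment up
to `z`. -/
theorem krewerasRel_least {S : Finset α} {P : Finset (Finset α)} {x : α}
    (hx : ∀ z ∈ S, x < z) (hP : ∀ B ∈ P, B ⊆ S) (z : α) :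
    KrewerasRel P x z ↔ Saturated P (· ≤ z) := by
  rw [KrewerasRel, ← saturated_not (p := (· ≤ z))]
  refine saturated_congr hP fun a ha => ?_
  simp [(hx a ha).not_ge]

theorem krewerasRel_symm {P : Finset (Finset α)} {x y : α} :
    KrewerasRel P x y ↔ KrewerasRel P y x := by
  unfold KrewerasRel
  simp only [iff_comm]

/-- The new point joins the outer block of the complement, so the inner blocks do not change. -/
theorem innerWeight_insert_singleton (f : Finset α → ℂ) {S : Finset α} {P : Finset (Finset α)}
    {x : α} (hx : ∀ z ∈ S, x < z) (hP : IsNCP S P) :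
    innerWeight f (insert x S) (insert {x} P) = innerWeight f S P := by
  classical
  have hrel (z z' : α) : KrewerasRel (insert {x} P) z z' ↔ KrewerasRel P z z' :=
    saturated_insert_singleton
  have hxS : x ∉ S := fun h => lt_irrefl _ (hx x h)
  rw [innerWeight, innerWeight, outerBlock_insert_singleton hx hP, Finset.prod_insert hxS,
    if_pos (Or.inl (Finset.mem_insert_self _ _)), one_mul]
  refine Finset.prod_congr rfl fun z hz => ?_
  have hzx : z ≠ x := (hx z hz).ne'
  by_cases hzo : z ∈ outerBlock S P
  · rw [if_pos (Or.inl (Finset.mem_insert_of_mem hzo)), if_pos (Or.inl hzo)]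
  have hnx : ¬ KrewerasRel P x z := by
    rw [krewerasRel_least hx hP.subset]
    exact fun h => hzo (mem_outerBlock.2 ⟨hz, h⟩)
  have hk : krewerasBlock (insert x S) (insert {x} P) z = krewerasBlock S P z := by
    ext u
    rw [mem_krewerasBlock, mem_krewerasBlock, hrel, Finset.mem_insert]
    constructor
    · rintro ⟨rfl | hu, h⟩
      · exact absurd (krewerasRel_symm.1 h) hnx
      · exact ⟨hu, h⟩
    · exact fun h => ⟨Or.inr h.1, h.2⟩
  rw [hk]
  refine if_congr ?_ rfl rfl
  simp only [Finset.mem_insert, hzx, hzo, false_or, hrel]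
  constructor
  · rintro ⟨u, rfl | hu, hlt, h⟩
    · exact absurd h hnx
    · exact ⟨u, hu, hlt, h⟩
  · rintro ⟨u, hu, hlt, h⟩
    exact ⟨u, Or.inr hu, hlt, h⟩

/-! #### Adding a new least element to an existing block -/

/-- Add `x` to the blocks that contain `y`. -/
def joinTo (x y : α) (B : Finset α) : Finset α := if y ∈ B then insert x B else B

/-- The partition that is made of a partition `P₁` of elements before `y`, and of a partition `P₂`
of `y` and elements after `y`, where `x` is added to the block of `y`. -/
def glue (x y : α) (P₁ P₂ : Finset (Finset α)) : Finset (Finset α) :=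
  P₁ ∪ P₂.image (joinTo x y)

theorem mem_joinTo {x y z : α} {B : Finset α} :
    z ∈ joinTo x y B ↔ z ∈ B ∨ z = x ∧ y ∈ B := by
  unfold joinTo
  split_ifs with h <;> simp [h, or_comm]

theorem mem_glue {x y : α} {P₁ P₂ : Finset (Finset α)} {B : Finset α} :
    B ∈ glue x y P₁ P₂ ↔ B ∈ P₁ ∨ ∃ C ∈ P₂, joinTo x y C = B := by
  simp [glue]

/-- As `p` takes the same truth value at `x` and `y`, adding `x` to the block of `y` imposes no new
condition. -/
theorem saturated_glue {x y : α} {P₁ P₂ : Finset (Finset α)} {p : α → Prop} (hp : p x ↔ p y) :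
    Saturated (glue x y P₁ P₂) p ↔ Saturated P₁ p ∧ Saturated P₂ p := by
  constructor
  · intro h
    refine ⟨fun B hB => h B (mem_glue.2 (Or.inl hB)), fun B hB a ha b hb => ?_⟩
    exact h (joinTo x y B) (mem_glue.2 (Or.inr ⟨B, hB, rfl⟩)) a (mem_joinTo.2 (Or.inl ha)) b
      (mem_joinTo.2 (Or.inl hb))
  · rintro ⟨h1, h2⟩ B hB
    rcases mem_glue.1 hB with hB | ⟨C, hC, rfl⟩
    · exact h1 B hB
    · intro a ha b hb
      rcases mem_joinTo.1 ha with ha' | ⟨rfl, ha'⟩ <;>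
        rcases mem_joinTo.1 hb with hb' | ⟨rfl, hb'⟩
      · exact h2 C hC a ha' b hb'
      · rw [hp]; exact h2 C hC a ha' y hb'
      · rw [hp]; exact h2 C hC y ha' b hb'
      · exact id

theorem not_saturated_glue {x y : α} {S : Finset α} {P₁ P₂ : Finset (Finset α)} {p : α → Prop}
    (hP : IsNCP S P₂) (hy : y ∈ S) (hp : ¬ (p x ↔ p y)) : ¬ Saturated (glue x y P₁ P₂) p := by
  intro h
  obtain ⟨B, hB, hyB⟩ := hP.cover y hy
  exact hp (h.iff (mem_glue.2 (Or.inr ⟨B, hB, rfl⟩)) (mem_joinTo.2 (Or.inr ⟨rfl, hyB⟩))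
    (mem_joinTo.2 (Or.inl hyB)))

section Glue

variable {S : Finset α} {x y : α} {P₁ P₂ : Finset (Finset α)}

theorem glue_saturated_le_of_lt (hy : y ∈ S)
    (h2 : IsNCP (S.filter (y ≤ ·)) P₂) {z : α} (hxz : x ≤ z) (hz : z < y) :
    ¬ Saturated (glue x y P₁ P₂) (· ≤ z) :=
  not_saturated_glue h2 (by simp [hy]) (by simp [hxz, hz])

theorem glue_saturated_le_of_ge (hx : ∀ z ∈ S, x < z) (hy : y ∈ S)
    (h1 : IsNCP (S.filter (· < y)) P₁) {z : α} (hz : y ≤ z) :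
    Saturated (glue x y P₁ P₂) (· ≤ z) ↔ Saturated P₂ (· ≤ z) := by
  rw [saturated_glue (by simp [hz, (hx y hy).le.trans hz]), and_iff_right]
  refine saturated_of_forall h1.subset fun a ha => ?_
  exact (Finset.mem_filter.1 ha).2.le.trans hz

theorem glue_krewerasRel_of_ge (hx : ∀ z ∈ S, x < z) (hy : y ∈ S)
    (h1 : IsNCP (S.filter (· < y)) P₁) {z z' : α} (hz : y ≤ z) (hz' : y ≤ z') :
    KrewerasRel (glue x y P₁ P₂) z z' ↔ KrewerasRel P₂ z z' := by
  rw [KrewerasRel, saturated_glue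
    (by simp [hz, hz', (hx y hy).le.trans hz, (hx y hy).le.trans hz']), and_iff_right]
  · rfl
  refine saturated_of_forall h1.subset fun a ha => ?_
  have := (Finset.mem_filter.1 ha).2.le
  simp [this.trans hz, this.trans hz']

theorem glue_krewerasRel_of_lt (h2 : IsNCP (S.filter (y ≤ ·)) P₂) {z z' : α}
    (hxz : x ≤ z) (hxz' : x ≤ z') (hz : z < y) (hz' : z' < y) :
    KrewerasRel (glue x y P₁ P₂) z z' ↔ KrewerasRel P₁ z z' := by
  rw [KrewerasRel, saturated_glue (by simp [hz.not_ge, hz'.not_ge, hxz, hxz']), and_iff_left]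
  · rfl
  refine saturated_of_forall h2.subset fun a ha => ?_
  have := (Finset.mem_filter.1 ha).2
  simp [(hz.trans_le this).not_ge, (hz'.trans_le this).not_ge]

theorem glue_not_krewerasRel (hy : y ∈ S) (h2 : IsNCP (S.filter (y ≤ ·)) P₂)
    {z z' : α} (hxz : x ≤ z) (hxz' : x ≤ z') (hz : z < y) (hz' : y ≤ z') :
    ¬ KrewerasRel (glue x y P₁ P₂) z z' :=
  not_saturated_glue h2 (by simp [hy]) (by simp [hxz, hxz', hz.not_ge, hz'])

/-- A point `z` with `x ≤ z < y` separates `x` from `y` inside one block, so it cannot be outer. -/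
theorem outerBlock_glue (hx : ∀ z ∈ S, x < z) (hy : y ∈ S)
    (h1 : IsNCP (S.filter (· < y)) P₁) (h2 : IsNCP (S.filter (y ≤ ·)) P₂) :
    outerBlock (insert x S) (glue x y P₁ P₂) = outerBlock (S.filter (y ≤ ·)) P₂ := by
  ext z
  rw [mem_outerBlock, mem_outerBlock, Finset.mem_insert, Finset.mem_filter]
  by_cases hyz : y ≤ z
  · rw [glue_saturated_le_of_ge hx hy h1 hyz]
    have : z ≠ x := ((hx y hy).trans_le hyz).ne'
    simp [hyz, this]
  · simp only [hyz, and_false, false_and, iff_false, not_and]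
    intro hz
    refine glue_saturated_le_of_lt hy h2 ?_ (not_le.1 hyz)
    rcases hz with rfl | hz
    · exact le_rfl
    · exact (hx z hz).le

/-- The join of `x` and `y` shields `P₁`: its outer block is closed up by `x` into an inner block,
whence the factor `f`. No point below `y` is related to one from `y` on, so all other inner blocks
are those of `P₁` and of `P₂`. -/
theorem innerWeight_glue (f : Finset α → ℂ) (hx : ∀ z ∈ S, x < z) (hy : y ∈ S)
    (h1 : IsNCP (S.filter (· < y)) P₁) (h2 : IsNCP (S.filter (y ≤ ·)) P₂) :
    innerWeight f (insert x S) (glue x y P₁ P₂) =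
      f (insert x (outerBlock (S.filter (· < y)) P₁)) * innerWeight f (S.filter (· < y)) P₁ *
        innerWeight f (S.filter (y ≤ ·)) P₂ := by
  classical
  have hxS : x ∉ S := fun h => lt_irrefl _ (hx x h)
  have hxy := hx y hy
  have hx1 : ∀ z ∈ S.filter (· < y), x < z := fun z hz => hx z (Finset.mem_filter.1 hz).1
  have hxle : ∀ z ∈ insert x S, x ≤ z := by
    intro z hz
    rcases Finset.mem_insert.1 hz with rfl | hz
    · exact le_rfl
    · exact (hx z hz).le
  have hrx {z : α} (hxz : x ≤ z) (hz : z < y) :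
      KrewerasRel (glue x y P₁ P₂) x z ↔ Saturated P₁ (· ≤ z) := by
    rw [glue_krewerasRel_of_lt h2 le_rfl hxz hxy hz]
    exact krewerasRel_least hx1 h1.subset z
  rw [innerWeight, outerBlock_glue hx hy h1 h2, Finset.prod_insert hxS, mul_assoc]
  congr 1
  · rw [if_neg]
    · congr 1
      ext z
      rw [mem_krewerasBlock, Finset.mem_insert, Finset.mem_insert, mem_outerBlock,
        Finset.mem_filter]
      constructor
      · rintro ⟨rfl | hz, h⟩
        · exact Or.inl rfl
        · rcases lt_or_ge z y with hzy | hzy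
          · exact Or.inr ⟨⟨hz, hzy⟩, (hrx (hx z hz).le hzy).1 h⟩
          · exact absurd h (glue_not_krewerasRel hy h2 le_rfl (hx z hz).le hxy hzy)
      · rintro (rfl | ⟨⟨hz, hzy⟩, h⟩)
        · exact ⟨Or.inl rfl, fun B _ a _ b _ _ => Iff.rfl⟩
        · exact ⟨Or.inr hz, (hrx (hx z hz).le hzy).2 h⟩
    · rintro (h | ⟨z, hz, hzx, -⟩)
      · exact hxS (Finset.mem_filter.1 (mem_outerBlock.1 h).1).1
      · exact (hxle z hz).not_gt hzx
  rw [← Finset.prod_filter_mul_prod_filter_not S (· < y)]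
  simp only [not_lt]
  congr 1
  · refine Finset.prod_congr rfl fun z hz => ?_
    obtain ⟨hzS, hzy⟩ := Finset.mem_filter.1 hz
    have hxz := hx z hzS
    have hno : z ∉ outerBlock (S.filter (y ≤ ·)) P₂ := fun h =>
      (Finset.mem_filter.1 (mem_outerBlock.1 h).1).2.not_gt hzy
    by_cases hzo : z ∈ outerBlock (S.filter (· < y)) P₁
    · rw [if_pos, if_pos (Or.inl hzo)]
      exact Or.inr ⟨x, Finset.mem_insert_self _ _, hxz, (hrx hxz.le hzy).2 (mem_outerBlock.1 hzo).2⟩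
    · have hnx : ¬ KrewerasRel (glue x y P₁ P₂) x z := fun h =>
        hzo (mem_outerBlock.2 ⟨hz, (hrx hxz.le hzy).1 h⟩)
      have hk : krewerasBlock (insert x S) (glue x y P₁ P₂) z =
          krewerasBlock (S.filter (· < y)) P₁ z := by
        ext u
        rw [mem_krewerasBlock, mem_krewerasBlock, Finset.mem_insert, Finset.mem_filter]
        constructor
        · rintro ⟨rfl | hu, h⟩
          · exact absurd (krewerasRel_symm.1 h) hnx
          · rcases lt_or_ge u y with huy | huy
            · exact ⟨⟨hu, huy⟩, (glue_krewerasRel_of_lt h2 hxz.le (hx u hu).le hzy huy).1 h⟩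
            · exact absurd h (glue_not_krewerasRel hy h2 hxz.le (hx u hu).le hzy huy)
        · rintro ⟨⟨hu, huy⟩, h⟩
          exact ⟨Or.inr hu, (glue_krewerasRel_of_lt h2 hxz.le (hx u hu).le hzy huy).2 h⟩
      rw [hk]
      refine if_congr ?_ rfl rfl
      simp only [hno, hzo, false_or]
      constructor
      · rintro ⟨u, hu, hlt, h⟩
        rcases Finset.mem_insert.1 hu with rfl | hu
        · exact absurd h hnx
        · have huy := hlt.trans hzy
          exact ⟨u, Finset.mem_filter.2 ⟨hu, huy⟩, hlt,
            (glue_krewerasRel_of_lt h2 (hx u hu).le hxz.le huy hzy).1 h⟩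
      · rintro ⟨u, hu, hlt, h⟩
        obtain ⟨hu, huy⟩ := Finset.mem_filter.1 hu
        exact ⟨u, Finset.mem_insert_of_mem hu, hlt,
          (glue_krewerasRel_of_lt h2 (hx u hu).le hxz.le huy hzy).2 h⟩
  · refine Finset.prod_congr rfl fun z hz => ?_
    obtain ⟨hzS, hzy⟩ := Finset.mem_filter.1 hz
    have hk : krewerasBlock (insert x S) (glue x y P₁ P₂) z =
        krewerasBlock (S.filter (y ≤ ·)) P₂ z := by
      ext u
      rw [mem_krewerasBlock, mem_krewerasBlock, Finset.mem_filter]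
      constructor
      · rintro ⟨hu, h⟩
        rcases lt_or_ge u y with huy | huy
        · exact absurd (krewerasRel_symm.1 h)
            (glue_not_krewerasRel hy h2 (hxle u hu) (hx z hzS).le huy hzy)
        · rcases Finset.mem_insert.1 hu with rfl | hu
          · exact absurd hxy huy.not_gt
          · exact ⟨⟨hu, huy⟩, (glue_krewerasRel_of_ge hx hy h1 hzy huy).1 h⟩
      · rintro ⟨⟨hu, huy⟩, h⟩
        exact ⟨Finset.mem_insert_of_mem hu, (glue_krewerasRel_of_ge hx hy h1 hzy huy).2 h⟩
    rw [hk]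
    refine if_congr (or_congr_right ?_) rfl rfl
    constructor
    · rintro ⟨u, hu, hlt, h⟩
      rcases lt_or_ge u y with huy | huy
      · exact absurd h (glue_not_krewerasRel hy h2 (hxle u hu) (hx z hzS).le huy hzy)
      · rcases Finset.mem_insert.1 hu with rfl | hu
        · exact absurd hxy huy.not_gt
        · exact ⟨u, Finset.mem_filter.2 ⟨hu, huy⟩, hlt,
            (glue_krewerasRel_of_ge hx hy h1 huy hzy).1 h⟩
    · rintro ⟨u, hu, hlt, h⟩
      obtain ⟨hu, huy⟩ := Finset.mem_filter.1 hu
      exact ⟨u, Finset.mem_insert_of_mem hu, hlt,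
        (glue_krewerasRel_of_ge hx hy h1 huy hzy).2 h⟩

end Glue

end SetPartitions

/-! ### Decomposition along the second element of the first block -/

section SetPartitions

variable {α : Type*} [LinearOrder α]

section Glue

variable {S : Finset α} {x y : α} {P₁ P₂ : Finset (Finset α)}

theorem eq_of_mem_joinTo {y z : α} {B : Finset α} (h : z ∈ joinTo x y B) (hz : z ≠ x) : z ∈ B := by
  rcases mem_joinTo.1 h with h | h
  · exact h
  · exact absurd h.1 hz

theorem erase_joinTo {B : Finset α} (hB : x ∉ B) : (joinTo x y B).erase x = B := by
  unfold joinTo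
  split_ifs
  · exact Finset.erase_insert hB
  · exact Finset.erase_eq_of_notMem hB

theorem IsNCP.glue (hx : ∀ z ∈ S, x < z) (hy : y ∈ S)
    (h1 : IsNCP (S.filter (· < y)) P₁) (h2 : IsNCP (S.filter (y ≤ ·)) P₂) :
    IsNCP (insert x S) (glue x y P₁ P₂) := by
  have hxy := hx y hy
  have b1 : ∀ B ∈ P₁, ∀ z ∈ B, z ∈ S ∧ x < z ∧ z < y := by
    intro B hB z hz
    obtain ⟨h, h'⟩ := Finset.mem_filter.1 (h1.subset B hB hz)
    exact ⟨h, hx z h, h'⟩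
  have b2 : ∀ B ∈ P₂, ∀ z ∈ B, z ∈ S ∧ x < z ∧ y ≤ z := by
    intro B hB z hz
    obtain ⟨h, h'⟩ := Finset.mem_filter.1 (h2.subset B hB hz)
    exact ⟨h, hx z h, h'⟩
  have b2' : ∀ B ∈ P₂, ∀ z ∈ joinTo x y B, z = x ∧ y ∈ B ∨ x < z ∧ y ≤ z ∧ z ∈ B := by
    intro B hB z hz
    rcases mem_joinTo.1 hz with h | h
    · exact Or.inr ⟨(b2 B hB z h).2.1, (b2 B hB z h).2.2, h⟩
    · exact Or.inl h
  refine ⟨?_, ?_, ?_, ?_, ?_⟩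
  · intro B hB
    rcases mem_glue.1 hB with hB | ⟨C, hC, rfl⟩
    · exact h1.nonempty B hB
    · obtain ⟨z, hz⟩ := h2.nonempty C hC
      exact ⟨z, mem_joinTo.2 (Or.inl hz)⟩
  · intro B hB z hz
    rcases mem_glue.1 hB with hB | ⟨C, hC, rfl⟩
    · exact Finset.mem_insert_of_mem (b1 B hB z hz).1
    · rcases mem_joinTo.1 hz with h | ⟨rfl, -⟩
      · exact Finset.mem_insert_of_mem (b2 C hC z h).1
      · exact Finset.mem_insert_self _ _
  · intro z hz
    rcases Finset.mem_insert.1 hz with rfl | hz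
    · obtain ⟨B, hB, hyB⟩ := h2.cover y (by simp [hy])
      exact ⟨_, mem_glue.2 (Or.inr ⟨B, hB, rfl⟩), mem_joinTo.2 (Or.inr ⟨rfl, hyB⟩)⟩
    · rcases lt_or_ge z y with hzy | hzy
      · obtain ⟨B, hB, hzB⟩ := h1.cover z (by simp [hz, hzy])
        exact ⟨B, mem_glue.2 (Or.inl hB), hzB⟩
      · obtain ⟨B, hB, hzB⟩ := h2.cover z (by simp [hz, hzy])
        exact ⟨_, mem_glue.2 (Or.inr ⟨B, hB, rfl⟩), mem_joinTo.2 (Or.inl hzB)⟩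
  · intro B hB₀ C hC₀ z hzB hzC
    rcases mem_glue.1 hB₀ with hB | ⟨B, hB, rfl⟩ <;>
      rcases mem_glue.1 hC₀ with hC | ⟨C, hC, rfl⟩
    · exact h1.eq_of_mem B hB C hC z hzB hzC
    · have := b1 B hB z hzB
      rcases b2' C hC z hzC with h | h
      · exact absurd h.1 this.2.1.ne'
      · exact absurd h.2.1 this.2.2.not_ge
    · have := b1 C hC z hzC
      rcases b2' B hB z hzB with h | h
      · exact absurd h.1 this.2.1.ne'
      · exact absurd h.2.1 this.2.2.not_ge
    · congr 1
      rcases b2' B hB z hzB with h | h <;> rcases b2' C hC z hzC with h' | h'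
      · exact h2.eq_of_mem B hB C hC y h.2 h'.2
      · exact absurd h.1 h'.1.ne'
      · exact absurd h'.1 h.1.ne'
      · exact h2.eq_of_mem B hB C hC z h.2.2 h'.2.2
  · intro B hB₀ C hC₀ a b c d hab hbc hcd ha hb hc hd
    rcases mem_glue.1 hB₀ with hB | ⟨B, hB, rfl⟩ <;>
      rcases mem_glue.1 hC₀ with hC | ⟨C, hC, rfl⟩
    · exact h1.noncrossing B hB C hC a b c d hab hbc hcd ha hb hc hd
    · have h3 := b1 B hB a ha
      have h4 := b1 B hB c hc
      rcases b2' C hC b hb with h | h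
      · exact absurd (h.1 ▸ hab) h3.2.1.not_gt
      · exact absurd (h.2.1.trans_lt hbc) h4.2.2.not_gt
    · have h3 := b1 C hC b hb
      have h4 := b1 C hC d hd
      rcases b2' B hB c hc with h | h
      · exact absurd (h.1 ▸ hbc) h3.2.1.not_gt
      · exact absurd (h.2.1.trans_lt hcd) h4.2.2.not_gt
    · have hxa : x ≤ a := by
        rcases b2' B hB a ha with h | h
        · exact h.1.ge
        · exact h.1.le
      have hb' := eq_of_mem_joinTo hb (hxa.trans_lt hab).ne'
      have hc' := eq_of_mem_joinTo hc (hxa.trans_lt (hab.trans hbc)).ne'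
      have hd' := eq_of_mem_joinTo hd (hxa.trans_lt (hab.trans (hbc.trans hcd))).ne'
      congr 1
      -- If `a` is the added point `x`, then `y` replaces it: `y` is in the same block and `y ≤ b`.
      -- For `y = b` the two blocks share a point, otherwise `y, b, c, d` is a crossing in `P₂`.
      rcases b2' B hB a ha with h | h
      · rcases (b2 C hC b hb').2.2.eq_or_lt with e | hlt
        · exact h2.eq_of_mem B hB C hC y h.2 (e ▸ hb')
        · exact h2.noncrossing B hB C hC y b c d hlt hbc hcd h.2 hb' hc' hd'
      · exact h2.noncrossing B hB C hC a b c d hab hbc hcd h.2.2 hb' hc' hd'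

theorem prod_glue (γ : Finset α → ℂ) (hx : ∀ z ∈ S, x < z)
    (h1 : IsNCP (S.filter (· < y)) P₁) (h2 : IsNCP (S.filter (y ≤ ·)) P₂) :
    ∏ B ∈ glue x y P₁ P₂, γ B = (∏ B ∈ P₁, γ B) * ∏ B ∈ P₂, γ (joinTo x y B) := by
  have hx2 : ∀ B ∈ P₂, x ∉ B := fun B hB h =>
    lt_irrefl x (hx x (Finset.mem_filter.1 (h2.subset B hB h)).1)
  rw [glue, Finset.prod_union, Finset.prod_image]
  · intro B hB C hC h
    rw [← erase_joinTo (y := y) (hx2 B hB), ← erase_joinTo (y := y) (hx2 C hC)]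
    exact congrArg (Finset.erase · x) h
  · rw [Finset.disjoint_left]
    intro B hB hB'
    obtain ⟨C, hC, rfl⟩ := Finset.mem_image.1 hB'
    obtain ⟨z, hz⟩ := h2.nonempty C hC
    have h3 := (Finset.mem_filter.1 (h1.subset _ hB (mem_joinTo.2 (Or.inl hz)))).2
    exact h3.not_ge (Finset.mem_filter.1 (h2.subset C hC hz)).2

/-- Together with `glue_filter_ge`, this recovers both parts from the glued partition, so gluing at
a given `y` is injective. -/
theorem glue_filter_lt
    (h1 : IsNCP (S.filter (· < y)) P₁) (h2 : IsNCP (S.filter (y ≤ ·)) P₂) {B : Finset α} :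
    B ∈ P₁ ↔ B ∈ glue x y P₁ P₂ ∧ ∀ b ∈ B, b < y := by
  constructor
  · intro hB
    exact ⟨mem_glue.2 (Or.inl hB), fun b hb => (Finset.mem_filter.1 (h1.subset B hB hb)).2⟩
  · rintro ⟨hB, hlt⟩
    rcases mem_glue.1 hB with hB | ⟨C, hC, rfl⟩
    · exact hB
    · obtain ⟨z, hz⟩ := h2.nonempty C hC
      exact absurd (Finset.mem_filter.1 (h2.subset C hC hz)).2
        (hlt z (mem_joinTo.2 (Or.inl hz))).not_ge

theorem glue_filter_ge (hx : ∀ z ∈ S, x < z)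
    (h1 : IsNCP (S.filter (· < y)) P₁) (h2 : IsNCP (S.filter (y ≤ ·)) P₂) {B : Finset α} :
    B ∈ P₂ ↔ ∃ C ∈ glue x y P₁ P₂, (∃ b ∈ C, y ≤ b) ∧ C.erase x = B := by
  have hx2 : ∀ B ∈ P₂, x ∉ B := fun B hB h =>
    lt_irrefl x (hx x (Finset.mem_filter.1 (h2.subset B hB h)).1)
  constructor
  · intro hB
    obtain ⟨z, hz⟩ := h2.nonempty B hB
    exact ⟨joinTo x y B, mem_glue.2 (Or.inr ⟨B, hB, rfl⟩),
      ⟨z, mem_joinTo.2 (Or.inl hz), (Finset.mem_filter.1 (h2.subset B hB hz)).2⟩,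
      erase_joinTo (hx2 B hB)⟩
  · rintro ⟨C, hC, ⟨b, hb, hyb⟩, rfl⟩
    rcases mem_glue.1 hC with hC | ⟨D, hD, rfl⟩
    · exact absurd hyb (Finset.mem_filter.1 (h1.subset C hC hb)).2.not_ge
    · rwa [erase_joinTo (hx2 D hD)]

/-- `y` is the second element of the block of `x`. -/
def IsSecond (x y : α) (P : Finset (Finset α)) : Prop :=
  ∃ B ∈ P, x ∈ B ∧ y ∈ B ∧ ∀ b ∈ B, b = x ∨ y ≤ b

theorem isSecond_glue (hy : y ∈ S)
    (h2 : IsNCP (S.filter (y ≤ ·)) P₂) : IsSecond x y (glue x y P₁ P₂) := by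
  obtain ⟨B, hB, hyB⟩ := h2.cover y (by simp [hy])
  refine ⟨_, mem_glue.2 (Or.inr ⟨B, hB, rfl⟩), mem_joinTo.2 (Or.inr ⟨rfl, hyB⟩),
    mem_joinTo.2 (Or.inl hyB), fun b hb => ?_⟩
  rcases mem_joinTo.1 hb with h | h
  · exact Or.inr (Finset.mem_filter.1 (h2.subset B hB h)).2
  · exact Or.inl h.1

theorem IsSecond.unique {P : Finset (Finset α)} {y' : α}
    (hP : IsNCP (insert x S) P) (hy : x < y) (hy' : x < y') (h : IsSecond x y P)
    (h' : IsSecond x y' P) : y = y' := by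
  obtain ⟨B, hB, hxB, hyB, hmin⟩ := h
  obtain ⟨C, hC, hxC, hyC, hmin'⟩ := h'
  obtain rfl := hP.eq_of_mem B hB C hC x hxB hxC
  apply le_antisymm
  · exact (hmin y' hyC).resolve_left hy'.ne'
  · exact (hmin' y hyB).resolve_left hy.ne'

theorem exists_isSecond {P : Finset (Finset α)}
    (hP : IsNCP (insert x S) P) (hxP : {x} ∉ P) : ∃ y ∈ S, IsSecond x y P := by
  obtain ⟨B, hB, hxB⟩ := hP.cover x (Finset.mem_insert_self _ _)
  have hne : (B.erase x).Nonempty := by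
    rw [Finset.nonempty_iff_ne_empty, Ne, Finset.erase_eq_empty_iff]
    rintro (rfl | rfl)
    · simp at hxB
    · exact hxP hB
  have hm := Finset.mem_erase.1 (Finset.min'_mem _ hne)
  refine ⟨(B.erase x).min' hne, ?_, B, hB, hxB, hm.2, fun b hb => ?_⟩
  · exact (Finset.mem_insert.1 (hP.subset B hB hm.2)).resolve_left hm.1
  · by_cases h : b = x
    · exact Or.inl h
    · exact Or.inr (Finset.min'_le _ _ (Finset.mem_erase.2 ⟨h, hb⟩))

/-- A block other than that of `x` with points `b < y ≤ b'` would cross it along `x < b < y < b'`.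
So each such block lies on one side of `y`, and the partition splits there. -/
theorem exists_glue {P : Finset (Finset α)} (hx : ∀ z ∈ S, x < z) (hy : y ∈ S)
    (hP : IsNCP (insert x S) P) (h : IsSecond x y P) :
    ∃ P₁ P₂, IsNCP (S.filter (· < y)) P₁ ∧ IsNCP (S.filter (y ≤ ·)) P₂ ∧ glue x y P₁ P₂ = P := by
  classical
  obtain ⟨V, hV, hxV, hyV, hmin⟩ := h
  have hxy := hx y hy
  have hS : ∀ B ∈ P, ∀ b ∈ B, b = x ∨ b ∈ S := fun B hB b hb =>
    Finset.mem_insert.1 (hP.subset B hB hb)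
  have hVB : ∀ B ∈ P, x ∈ B → B = V := fun B hB hxB => hP.eq_of_mem B hB V hV x hxB hxV
  have hVy : ∀ B ∈ P, y ∈ B → B = V := fun B hB hxB => hP.eq_of_mem B hB V hV y hxB hyV
  -- a block other than that of `x` lies on one side of `y`
  have hside : ∀ B ∈ P, B ≠ V → ∀ b ∈ B, ∀ b' ∈ B, b < y → y ≤ b' → False := by
    intro B hB hBV b hb b' hb' hlt hle
    have hbx : x < b := by
      rcases hS B hB b hb with rfl | h
      · exact absurd (hVB B hB hb) hBV
      · exact hx b h
    have hyb' : y < b' := by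
      refine lt_of_le_of_ne hle ?_
      rintro rfl
      exact hBV (hVy B hB hb')
    exact hBV (hP.noncrossing V hV B hB x b y b' hbx hlt hyb' hxV hb hyV hb').symm
  have hlow : ∀ B ∈ P, (∀ b ∈ B, b < y) → x ∉ B := by
    intro B hB hlt hxB
    rw [hVB B hB hxB] at hlt
    exact lt_irrefl _ (hlt y hyV)
  have hhigh : ∀ B ∈ P, (∃ b ∈ B, y ≤ b) → ∀ b ∈ B, b = x ∨ y ≤ b := by
    rintro B hB ⟨b', hb', hle⟩ b hb
    by_cases hBV : B = V
    · subst hBV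
      exact hmin b hb
    · exact Or.inr (not_lt.1 fun hlt => hside B hB hBV b hb b' hb' hlt hle)
  set P₁ := P.filter (fun B => ∀ b ∈ B, b < y) with hP₁
  set P₂ := (P.filter (fun B => ∃ b ∈ B, y ≤ b)).image (Finset.erase · x) with hP₂
  have m1 : ∀ {B}, B ∈ P₁ ↔ B ∈ P ∧ ∀ b ∈ B, b < y := by simp [hP₁]
  have m2 : ∀ {B}, B ∈ P₂ ↔ ∃ C ∈ P, (∃ b ∈ C, y ≤ b) ∧ C.erase x = B := by
    intro B
    simp only [hP₂, Finset.mem_image, Finset.mem_filter]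
    constructor
    · rintro ⟨C, ⟨h1, h2⟩, h3⟩
      exact ⟨C, h1, h2, h3⟩
    · rintro ⟨C, h1, h2, h3⟩
      exact ⟨C, ⟨h1, h2⟩, h3⟩
  have hjoin : ∀ B ∈ P, (∃ b ∈ B, y ≤ b) → joinTo x y (B.erase x) = B := by
    intro B hB _
    unfold joinTo
    split_ifs with h
    · have := hVy B hB (Finset.mem_of_mem_erase h)
      exact Finset.insert_erase (this ▸ hxV)
    · refine Finset.erase_eq_of_notMem fun hxB => h ?_
      rw [hVB B hB hxB]
      exact Finset.mem_erase.2 ⟨hxy.ne', hyV⟩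
  refine ⟨P₁, P₂, ⟨?_, ?_, ?_, ?_, ?_⟩, ⟨?_, ?_, ?_, ?_, ?_⟩, ?_⟩
  · exact fun B hB => hP.nonempty B (m1.1 hB).1
  · intro B hB b hb
    have hB' := m1.1 hB
    refine Finset.mem_filter.2 ⟨(hS B hB'.1 b hb).resolve_left ?_, hB'.2 b hb⟩
    rintro rfl
    exact hlow B hB'.1 hB'.2 hb
  · intro z hz
    obtain ⟨hzS, hzy⟩ := Finset.mem_filter.1 hz
    obtain ⟨B, hB, hzB⟩ := hP.cover z (Finset.mem_insert_of_mem hzS)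
    refine ⟨B, m1.2 ⟨hB, fun b hb => not_le.1 fun hle => ?_⟩, hzB⟩
    rcases hhigh B hB ⟨b, hb, hle⟩ z hzB with h | h
    · exact (hx z hzS).ne' h
    · exact hzy.not_ge h
  · exact fun B hB C hC => hP.eq_of_mem B (m1.1 hB).1 C (m1.1 hC).1
  · exact fun B hB C hC => hP.noncrossing B (m1.1 hB).1 C (m1.1 hC).1
  · intro B hB
    obtain ⟨C, hC, ⟨b, hb, hle⟩, rfl⟩ := m2.1 hB
    exact ⟨b, Finset.mem_erase.2 ⟨(hxy.trans_le hle).ne', hb⟩⟩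
  · intro B hB b hb
    obtain ⟨C, hC, hC', rfl⟩ := m2.1 hB
    obtain ⟨hbx, hb⟩ := Finset.mem_erase.1 hb
    exact Finset.mem_filter.2 ⟨(hS C hC b hb).resolve_left hbx,
      (hhigh C hC hC' b hb).resolve_left hbx⟩
  · intro z hz
    obtain ⟨hzS, hzy⟩ := Finset.mem_filter.1 hz
    obtain ⟨B, hB, hzB⟩ := hP.cover z (Finset.mem_insert_of_mem hzS)
    exact ⟨B.erase x, m2.2 ⟨B, hB, ⟨z, hzB, hzy⟩, rfl⟩,
      Finset.mem_erase.2 ⟨(hx z hzS).ne', hzB⟩⟩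
  · intro B hB₀ C hC₀ z hzB hzC
    obtain ⟨B, hB, -, rfl⟩ := m2.1 hB₀
    obtain ⟨C, hC, -, rfl⟩ := m2.1 hC₀
    rw [hP.eq_of_mem B hB C hC z (Finset.mem_of_mem_erase hzB) (Finset.mem_of_mem_erase hzC)]
  · intro B hB₀ C hC₀ a b c d hab hbc hcd ha hb hc hd
    obtain ⟨B, hB, -, rfl⟩ := m2.1 hB₀
    obtain ⟨C, hC, -, rfl⟩ := m2.1 hC₀
    rw [hP.noncrossing B hB C hC a b c d hab hbc hcd (Finset.mem_of_mem_erase ha)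
      (Finset.mem_of_mem_erase hb) (Finset.mem_of_mem_erase hc) (Finset.mem_of_mem_erase hd)]
  · ext B
    rw [mem_glue]
    constructor
    · rintro (hB | ⟨C, hC, rfl⟩)
      · exact (m1.1 hB).1
      · obtain ⟨D, hD, hD', rfl⟩ := m2.1 hC
        rwa [hjoin D hD hD']
    · intro hB
      by_cases h : ∃ b ∈ B, y ≤ b
      · exact Or.inr ⟨B.erase x, m2.2 ⟨B, hB, h, rfl⟩, hjoin B hB h⟩
      · push Not at h
        exact Or.inl (m1.2 ⟨hB, h⟩)

end Glue

/-- Decomposition of the non-crossing partitions of a set according to the second element of the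
block of its least element. -/
theorem sum_ncp_insert {S : Finset α} {x : α} (hx : ∀ z ∈ S, x < z)
    (W : Finset (Finset α) → ℂ) :
    ∑ P ∈ ncp (insert x S), W P = ∑ P ∈ ncp S, W (insert {x} P) +
      ∑ y ∈ S, ∑ P₁ ∈ ncp (S.filter (· < y)), ∑ P₂ ∈ ncp (S.filter (y ≤ ·)),
        W (glue x y P₁ P₂) := by
  classical
  have hxS : x ∉ S := fun h => lt_irrefl _ (hx x h)
  rw [← Finset.sum_filter_add_sum_filter_not (ncp (insert x S)) ({x} ∈ ·)]
  congr 1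
  · refine (Finset.sum_nbij' (insert {x} ·) (Finset.erase · {x}) ?_ ?_ ?_ ?_ ?_).symm
    · intro P hP
      simp only [Finset.mem_filter, mem_ncp] at hP ⊢
      exact ⟨hP.insert_singleton hxS, Finset.mem_insert_self _ _⟩
    · intro P hP
      simp only [Finset.mem_filter, mem_ncp] at hP ⊢
      exact hP.1.erase_singleton hxS hP.2
    · intro P hP
      refine Finset.erase_insert fun h => hxS ?_
      exact (mem_ncp.1 hP).subset _ h (Finset.mem_singleton_self x)
    · intro P hP
      exact Finset.insert_erase (Finset.mem_filter.1 hP).2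
    · intro P _
      rfl
  · simp only [← Finset.sum_product']
    rw [Finset.sum_sigma']
    refine (Finset.sum_bij (fun q _ => glue x q.1 q.2.1 q.2.2) ?_ ?_ ?_ ?_).symm
    · rintro ⟨y, P₁, P₂⟩ hq
      simp only [Finset.mem_sigma, Finset.mem_product, mem_ncp] at hq
      obtain ⟨hy, h1, h2⟩ := hq
      rw [Finset.mem_filter, mem_ncp]
      refine ⟨h1.glue hx hy h2, fun h => ?_⟩
      obtain ⟨B, hB, hxB, hyB, -⟩ := isSecond_glue (P₁ := P₁) hy h2
      have := (h1.glue hx hy h2).eq_of_mem B hB _ h x hxB (Finset.mem_singleton_self x)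
      rw [this, Finset.mem_singleton] at hyB
      exact (hx y hy).ne' hyB
    · rintro ⟨y, P₁, P₂⟩ hq ⟨y', P₁', P₂'⟩ hq' h
      simp only [Finset.mem_sigma, Finset.mem_product, mem_ncp] at hq hq' h
      obtain ⟨hy, h1, h2⟩ := hq
      obtain ⟨hy', h1', h2'⟩ := hq'
      have hyy : y = y' := by
        refine IsSecond.unique (h1.glue hx hy h2) (hx y hy) (hx y' hy') (isSecond_glue hy h2) ?_
        rw [h]
        exact isSecond_glue hy' h2'
      subst hyy
      have e1 : P₁ = P₁' := by
        ext B
        rw [glue_filter_lt h1 h2, glue_filter_lt h1' h2', h]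
      have e2 : P₂ = P₂' := by
        ext B
        rw [glue_filter_ge hx h1 h2, glue_filter_ge hx h1' h2', h]
      rw [e1, e2]
    · intro P hP
      rw [Finset.mem_filter, mem_ncp] at hP
      obtain ⟨y, hy, hsec⟩ := exists_isSecond hP.1 hP.2
      obtain ⟨P₁, P₂, h1, h2, rfl⟩ := exists_glue hx hy hP.1 hsec
      refine ⟨⟨y, P₁, P₂⟩, ?_, rfl⟩
      simp only [Finset.mem_sigma, Finset.mem_product, mem_ncp]
      exact ⟨hy, h1, h2⟩
    · intro q _
      rfl

/-- Either `x` is a singleton and belongs to the outer block of the complement, or its block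
continues at some `y`. Then the outer block of the part before `y`, completed by `x`, is an inner
block and so carries `f` instead of `F`. -/
theorem ncpSum_insert {S : Finset α} {x : α} (hx : ∀ z ∈ S, x < z) (γ f F : Finset α → ℂ) :
    ncpSum γ f F (insert x S) = γ {x} * ncpSum γ f (fun C => F (insert x C)) S +
      ∑ y ∈ S, ncpSum γ f (fun C => f (insert x C)) (S.filter (· < y)) *
        ncpSum (fun B => γ (joinTo x y B)) f F (S.filter (y ≤ ·)) := by
  have hxS : x ∉ S := fun h => lt_irrefl _ (hx x h)
  rw [ncpSum, sum_ncp_insert hx]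
  congr 1
  · rw [ncpSum, Finset.mul_sum]
    refine Finset.sum_congr rfl fun P hP => ?_
    have hP' := mem_ncp.1 hP
    rw [outerBlock_insert_singleton hx hP', innerWeight_insert_singleton f hx hP',
      Finset.prod_insert fun h => hxS (hP'.subset _ h (Finset.mem_singleton_self x))]
    ring
  · refine Finset.sum_congr rfl fun y hy => ?_
    rw [ncpSum, ncpSum, Finset.sum_mul_sum]
    refine Finset.sum_congr rfl fun P₁ h1 => Finset.sum_congr rfl fun P₂ h2 => ?_
    rw [mem_ncp] at h1 h2
    rw [outerBlock_glue hx hy h1 h2, innerWeight_glue f hx hy h1 h2, prod_glue γ hx h1 h2]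
    ring

/-! ### Comparison with the sums over words -/

variable {β : Type*}

/-- The restriction of the word `w` to a finite set of positions. -/
def wordOn (w : α → β) (B : Finset α) : List β := (B.sort (· ≤ ·)).map w

@[simp] theorem wordOn_empty (w : α → β) : wordOn w ∅ = [] := by simp [wordOn]

theorem wordOn_insert (w : α → β) {S : Finset α} {x : α} (hx : ∀ z ∈ S, x < z) :
    wordOn w (insert x S) = w x :: wordOn w S := by
  rw [wordOn, Finset.sort_insert _ (fun b hb => (hx b hb).le) fun h => lt_irrefl _ (hx x h)]
  rfl

theorem cutSum_wordOn (w : α → β) (H : List β → ℂ) (K : β → List β → ℂ) (S : Finset α) :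
    cutSum H K (wordOn w S) =
      ∑ y ∈ S, H (wordOn w (S.filter (· < y))) * K (w y) (wordOn w (S.filter (y < ·))) := by
  induction S using Finset.induction_on_min generalizing H with
  | empty => simp [cutSum]
  | insert x S hx ih =>
    have hxS : x ∉ S := fun h => lt_irrefl _ (hx x h)
    rw [wordOn_insert w hx, cutSum, ih, Finset.sum_insert hxS]
    congr 1
    · have e1 : (insert x S).filter (· < x) = ∅ := by
        ext z
        simp only [Finset.mem_filter, Finset.mem_insert, Finset.notMem_empty, iff_false, not_and,
          not_lt]
        rintro (rfl | hz)
        · exact le_rfl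
        · exact (hx z hz).le
      have e2 : (insert x S).filter (x < ·) = S := by
        ext z
        simp only [Finset.mem_filter, Finset.mem_insert]
        constructor
        · rintro ⟨rfl | hz, h⟩
          · exact absurd h (lt_irrefl _)
          · exact hz
        · exact fun hz => ⟨Or.inr hz, hx z hz⟩
      rw [e1, e2, wordOn_empty]
    · refine Finset.sum_congr rfl fun y hy => ?_
      have e1 : (insert x S).filter (· < y) = insert x (S.filter (· < y)) := by
        rw [Finset.filter_insert, if_pos (hx y hy)]
      have e2 : (insert x S).filter (y < ·) = S.filter (y < ·) := by
        rw [Finset.filter_insert, if_neg (hx y hy).not_gt]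
      rw [e1, e2, wordOn_insert w fun z hz => hx z (Finset.mem_filter.1 hz).1, shift_apply]

/-- Giving the block of the least element its own weight `H`, evaluated on the letters after `x`,
makes the statement reproduce itself: passing to the second element `y` replaces `H` by its shift.
The bound `n` makes the assumption available on all the gaps. -/
theorem ncpSum_insert_eq_blockSum (w : α → β) (g f F : List β → ℂ) (n : ℕ)
    (hn : ∀ (F : List β → ℂ) (S : Finset α), S.card ≤ n →
      ncpSum (fun B => g (wordOn w B)) (fun B => f (wordOn w B)) (fun B => F (wordOn w B)) S =
        box g f F (wordOn w S))
    (H : List β → ℂ) {S : Finset α} {x : α} (hx : ∀ z ∈ S, x < z) (hS : S.card ≤ n) :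
    ncpSum (fun B => if x ∈ B then H (wordOn w (B.erase x)) else g (wordOn w B))
        (fun B => f (wordOn w B)) (fun B => F (wordOn w B)) (insert x S) =
      blockSum (fun y => box g f (shift y f)) (fun z => box g f (shift z F)) H (w x)
        (wordOn w S) := by
  induction h : S.card using Nat.strong_induction_on generalizing S H x with
  | _ m ih =>
    have hxB : ∀ B ⊆ S, x ∉ B := fun B hB h => lt_irrefl _ (hx x (hB h))
    have key (F : List β → ℂ) {S' : Finset α} (hS' : S' ⊆ S) :
        ncpSum (fun B => if x ∈ B then H (wordOn w (B.erase x)) else g (wordOn w B))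
          (fun B => f (wordOn w B)) (fun B => F (wordOn w (insert x B))) S' =
        box g f (shift (w x) F) (wordOn w S') := by
      rw [← hn _ _ ((Finset.card_le_card hS').trans hS)]
      refine ncpSum_congr (fun B hB => ?_) (fun B _ => rfl) fun B hB => ?_
      · rw [if_neg (hxB B (hB.trans hS'))]
      · rw [wordOn_insert w fun z hz => hx z (hS' (hB hz))]
        rfl
    rw [ncpSum_insert hx, blockSum_eq, cutSum_wordOn, key F subset_rfl]
    congr 1
    · simp
    · refine Finset.sum_congr rfl fun y hy => ?_
      rw [key f (Finset.filter_subset _ _)]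
      congr 1
      have e : S.filter (y ≤ ·) = insert y (S.filter (y < ·)) := by
        ext z
        simp only [Finset.mem_filter, Finset.mem_insert, le_iff_eq_or_lt]
        constructor
        · rintro ⟨hz, rfl | h⟩
          · exact Or.inl rfl
          · exact Or.inr ⟨hz, h⟩
        · rintro (rfl | ⟨hz, h⟩)
          · exact ⟨hy, Or.inl rfl⟩
          · exact ⟨hz, Or.inr h⟩
      have hcard : (S.filter (y < ·)).card < m := by
        rw [← h]
        refine Finset.card_lt_card (Finset.filter_ssubset.2 ⟨y, hy, lt_irrefl y⟩)
      rw [← ih _ hcard (shift (w y) H) (fun z hz => (Finset.mem_filter.1 hz).2) (hcard.le.trans (h ▸ hS)) rfl, ← e]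
      refine ncpSum_congr (fun B hB => ?_) (fun B _ => rfl) fun B _ => rfl
      have hBS := hB.trans (Finset.filter_subset _ _)
      unfold joinTo
      by_cases hyB : y ∈ B
      · rw [if_pos hyB, if_pos hyB, if_pos (Finset.mem_insert_self _ _),
          Finset.erase_insert (hxB B hBS), shift_apply, ← wordOn_insert w, Finset.insert_erase hyB]
        intro z hz
        obtain ⟨hzy, hz⟩ := Finset.mem_erase.1 hz
        exact lt_of_le_of_ne (Finset.mem_filter.1 (hB hz)).2 hzy.symm
      · rw [if_neg hyB, if_neg hyB, if_neg (hxB B hBS)]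

/-- The sum over the non-crossing partitions of a set of positions is given by the recursion on
words. -/
theorem ncpSum_eq_box (w : α → β) (g f F : List β → ℂ) (S : Finset α) :
    ncpSum (fun B => g (wordOn w B)) (fun B => f (wordOn w B)) (fun B => F (wordOn w B)) S =
      box g f F (wordOn w S) := by
  induction h : S.card using Nat.strong_induction_on generalizing S F with
  | _ n ih =>
    rcases S.eq_empty_or_nonempty with rfl | hne
    · rw [ncpSum_empty, wordOn_empty, box_nil]
    · set x := S.min' hne with hxdef
      have hxS : x ∈ S := S.min'_mem hne
      have hx : ∀ z ∈ S.erase x, x < z := fun z hz => S.min'_lt_of_mem_erase_min' hne hz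
      have hcard : (S.erase x).card < n := h ▸ Finset.card_erase_lt_of_mem hxS
      have key := ncpSum_insert_eq_blockSum w g f F (S.erase x).card
        (fun F S' hS' => ih _ (by omega) F S' rfl) (shift (w x) g) hx le_rfl
      rw [← box_cons, ← wordOn_insert w hx, Finset.insert_erase hxS] at key
      rw [← key]
      refine ncpSum_congr (fun B hB => ?_) (fun B _ => rfl) fun B _ => rfl
      by_cases hxB : x ∈ B
      · rw [if_pos hxB, shift_apply, ← wordOn_insert w, Finset.insert_erase hxB]
        exact fun z hz => hx z (Finset.erase_subset_erase x hB hz)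
      · rw [if_neg hxB]

end SetPartitions

/-! ### The relative Kreweras complement -/

section RelKreweras

variable {n : ℕ}

theorem self_mem_part (π : Finpartition (Finset.univ : Finset (Fin n))) (x : Fin n) :
    x ∈ π.part x :=
  π.mem_part_self.2 (Finset.mem_univ x)

theorem part_mem_parts (π : Finpartition (Finset.univ : Finset (Fin n))) (x : Fin n) :
    π.part x ∈ π.parts :=
  π.part_mem.2 (Finset.mem_univ x)

theorem part_subset_part {π ρ : Finpartition (Finset.univ : Finset (Fin n))} (h : π ≤ ρ)
    (x : Fin n) : π.part x ⊆ ρ.part x := by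
  obtain ⟨C, hC, hle⟩ := h (part_mem_parts π x)
  rw [ρ.part_eq_of_mem hC (hle (self_mem_part π x))]
  exact hle

theorem blockCycle_spec {B : Finset (Fin n)} {x : Fin n} (hx : x ∈ B) :
    x < blockCycle B x ∧ (∀ z ∈ B, x < z → blockCycle B x ≤ z) ∨
      ∀ z ∈ B, blockCycle B x ≤ z ∧ z ≤ x := by
  have hl : (B.sort (· ≤ ·)).SortedLT := B.sortedLT_sort
  have hmem (z : Fin n) : z ∈ B ↔ z ∈ B.sort (· ≤ ·) := (Finset.mem_sort _).symm
  unfold blockCycle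
  simp only [hmem] at hx ⊢
  generalize B.sort (· ≤ ·) = l at hl hx ⊢
  obtain ⟨i, hi, rfl⟩ := List.getElem_of_mem hx
  rcases Nat.lt_or_ge (i + 1) l.length with h | h
  · left
    rw [List.formPerm_apply_lt_getElem l hl.nodup i h]
    refine ⟨hl.getElem_lt_getElem_iff.2 (Nat.lt_succ_self i), fun z hz hlt => ?_⟩
    obtain ⟨j, hj, rfl⟩ := List.getElem_of_mem hz
    exact hl.getElem_le_getElem_iff.2 (hl.getElem_lt_getElem_iff.1 hlt)
  · right
    have hlen : i + 1 = l.length := le_antisymm hi h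
    intro z hz
    obtain ⟨j, hj, rfl⟩ := List.getElem_of_mem hz
    rw [List.formPerm_apply_getElem l hl.nodup i hi]
    simp only [hlen, Nat.mod_self]
    exact ⟨hl.getElem_le_getElem_iff.2 (Nat.zero_le _), hl.getElem_le_getElem_iff.2 (by omega)⟩

/-- `perm π x` is the next element of the block of `x`, or its least element if `x` is its greatest
element. -/
theorem perm_spec (π : Finpartition (Finset.univ : Finset (Fin n))) (x : Fin n) :
    x < perm π x ∧ (∀ z ∈ π.part x, x < z → perm π x ≤ z) ∨
      ∀ z ∈ π.part x, perm π x ≤ z ∧ z ≤ x :=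
  blockCycle_spec (self_mem_part π x)

theorem perm_mem_part (π : Finpartition (Finset.univ : Finset (Fin n))) (x : Fin n) :
    perm π x ∈ π.part x := by
  rw [← part_perm π x]
  exact self_mem_part _ _

/-- The blocks of `P` that are contained in `C`. -/
def blocksIn (P : Finset (Finset (Fin n))) (C : Finset (Fin n)) : Finset (Finset (Fin n)) :=
  P.filter (· ⊆ C)

theorem mem_blocksIn {P : Finset (Finset (Fin n))} {B C : Finset (Fin n)} :
    B ∈ blocksIn P C ↔ B ∈ P ∧ B ⊆ C := by
  simp [blocksIn]

theorem krewerasRel_refl {α : Type*} [LinearOrder α] (P : Finset (Finset α)) (x : α) :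
    KrewerasRel P x x :=
  fun _ _ _ _ _ _ _ => Iff.rfl

theorem KrewerasRel.trans {α : Type*} [LinearOrder α] {P : Finset (Finset α)} {x y z : α}
    (h : KrewerasRel P x y) (h' : KrewerasRel P y z) : KrewerasRel P x z := by
  intro B hB a ha b hb hab
  have h1 : (a ≤ x ↔ a ≤ y) ↔ (b ≤ x ↔ b ≤ y) := h.iff hB ha hb
  have h2 : (a ≤ y ↔ a ≤ z) ↔ (b ≤ y ↔ b ≤ z) := h'.iff hB ha hb
  grind

/-- With `z = P_ρ x` and `y = P_π⁻¹ z`, the points `x, z` are cyclically consecutive in a block of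
`ρ`, and `y, z` in a block of `π`. Another block of `π` with points both inside and outside the
interval between `x` and `y` would cross the block of `y` and `z`; that block itself cannot have
such points because `y` and `z` are consecutive. -/
theorem krewerasRel_step {π ρ : NC n} (h : π ≤ ρ) (x : Fin n) :
    ((perm π.1)⁻¹ * perm ρ.1) x ∈ ρ.1.part x ∧
      KrewerasRel (blocksIn π.1.parts (ρ.1.part x)) x (((perm π.1)⁻¹ * perm ρ.1) x) := by
  set y := ((perm π.1)⁻¹ * perm ρ.1) x with hy
  set z := perm ρ.1 x with hz
  have hyz : perm π.1 y = z := (perm π.1).apply_symm_apply z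
  have hzC : z ∈ ρ.1.part x := perm_mem_part ρ.1 x
  have hzB : z ∈ π.1.part y := hyz ▸ perm_mem_part π.1 y
  have hyB := self_mem_part π.1 y
  have hCy : ρ.1.part y = ρ.1.part x := by
    rw [← ρ.1.part_eq_of_mem (part_mem_parts ρ.1 y) (part_subset_part h y hzB),
      ρ.1.part_eq_of_mem (part_mem_parts ρ.1 x) hzC]
  have hyC : y ∈ ρ.1.part x := hCy ▸ self_mem_part ρ.1 y
  refine ⟨hyC, ?_⟩
  intro B hB a ha b hb hab
  obtain ⟨hB, hBC⟩ := mem_blocksIn.1 hB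
  have hB0 := part_mem_parts π.1 y
  have haC := hBC ha
  have hbC := hBC hb
  have hsx := perm_spec ρ.1 x
  have hsy := perm_spec π.1 y
  rw [hyz] at hsy
  rw [← hz] at hsx
  by_contra hnb
  have cross := fun p q r s h1 h2 h3 => π.2 B hB _ hB0 p q r s h1 h2 h3
  have cross' := fun p q r s h1 h2 h3 => π.2 _ hB0 B hB p q r s h1 h2 h3
  -- `b` lies strictly between `y` and `z` (or between `z` and `y`), `a` does not
  have hne : B ≠ π.1.part y := by
    rintro rfl
    -- No crossing is available when `B` is the block of `y` and `z`; the cases are whether `x` ends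
    -- its `ρ`-block and whether `y` ends its `π`-block.
    rcases hsx with ⟨hxz, hx⟩ | hx <;> rcases hsy with ⟨hlt, hnext⟩ | hend
    · have h1 : y ≤ x := not_lt.1 fun hlt' => (hx y hyC hlt').not_gt hlt
      have h2 : y < b := by
        by_contra hyb
        exact hnb ⟨fun _ => not_lt.1 hyb, fun _ => (not_lt.1 hyb).trans h1⟩
      have h3 : b ≤ x := by
        by_contra hbx
        exact hnb ⟨fun h => absurd h hbx, fun h => absurd h2 h.not_gt⟩
      exact ((hnext b hb h2).trans h3).not_gt hxz
    · have h1 := (hend a ha)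
      have h2 := (hend b hb)
      have hax : ¬ a ≤ x := (hxz.trans_le h1.1).not_ge
      exact hax (hab.2 h1.2)
    · exact (hx y hyC).1.not_gt hlt
    · have h1 := (hend b hb).2
      exact hnb ⟨fun _ => h1, fun _ => (hx b hbC).2⟩
  have haz : a ≠ z := fun e => hne (π.1.eq_of_mem_parts hB hB0 ha (e ▸ hzB))
  have hay : a ≠ y := fun e => hne (π.1.eq_of_mem_parts hB hB0 ha (e ▸ hyB))
  have hbz : b ≠ z := fun e => hne (π.1.eq_of_mem_parts hB hB0 hb (e ▸ hzB))
  have hby : b ≠ y := fun e => hne (π.1.eq_of_mem_parts hB hB0 hb (e ▸ hyB))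
  rcases hsx with ⟨hxz, hx⟩ | hx
  · rcases hsy with ⟨hlt, hnext⟩ | hend
    · have h1 : y ≤ x := not_lt.1 fun hlt' => (hx y hyC hlt').not_gt hlt
      have h2 : y < b := by
        by_contra hyb
        exact hnb ⟨fun _ => not_lt.1 hyb, fun _ => (not_lt.1 hyb).trans h1⟩
      have h3 : b ≤ x := by
        by_contra hbx
        exact hnb ⟨fun h => absurd h hbx, fun h => absurd h2 h.not_gt⟩
      have h4 : b < z := h3.trans_lt hxz
      rcases le_or_gt a y with h5 | h5
      · exact hne (cross a y b z (lt_of_le_of_ne h5 hay) h2 h4 ha hyB hb hzB)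
      · have h6 : x < a := not_le.1 fun h => (hab.1 h).not_gt h5
        have h7 := lt_of_le_of_ne (hx a haC h6) haz.symm
        exact hne (cross' y b z a h2 h4 h7 hyB hb hzB ha).symm
    · have hzy := (hend y hyB).1
      have h1 : x < b := by
        by_contra hbx
        have hbx := not_lt.1 hbx
        exact hnb ⟨fun _ => hbx.trans (hxz.le.trans hzy), fun _ => hbx⟩
      have h2 : b ≤ y := by
        by_contra hb'
        exact hnb ⟨fun h => absurd h1 h.not_gt, fun h => absurd h hb'⟩
      have h3 := lt_of_le_of_ne (hx b hbC h1) hbz.symm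
      have h4 := lt_of_le_of_ne h2 hby
      rcases le_or_gt a x with h5 | h5
      · exact hne (cross a z b y (h5.trans_lt hxz) h3 h4 ha hzB hb hyB)
      · have h6 : y < a := not_le.1 fun h => (hab.2 h).not_gt h5
        exact hne (cross' z b y a h3 h4 h6 hzB hb hyB ha).symm
  · have hax := (hx a haC).2
    have h1 := lt_of_le_of_ne (hab.1 hax) hay
    have h2 := lt_of_le_of_ne (hx a haC).1 haz.symm
    have h3 : y < b := by
      by_contra hyb
      exact hnb ⟨fun _ => not_lt.1 hyb, fun _ => (hx b hbC).2⟩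
    exact hne (cross' z a y b h2 h1 h3 hzB ha hyB hb).symm

/-- For `x < y` the successor of `x` in its `ρ`-block lies in the interval `(x, y]`. This interval
is a union of `π`-blocks of that `ρ`-block, so the image `u` of `x` also satisfies `x < u ≤ y`;
iterating reaches `y`. -/
theorem sameCycle_of_krewerasRel {π ρ : NC n} (h : π ≤ ρ) {x y : Fin n} (hxy : x ≤ y)
    (hy : y ∈ ρ.1.part x) (hrel : KrewerasRel (blocksIn π.1.parts (ρ.1.part x)) x y) :
    ((perm π.1)⁻¹ * perm ρ.1).SameCycle x y := by
  induction hd : (y : ℕ) - x using Nat.strong_induction_on generalizing x with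
  | _ d ih =>
    rcases hxy.eq_or_lt with rfl | hlt
    · exact Equiv.Perm.SameCycle.refl _ _
    obtain ⟨h1, h2⟩ := krewerasRel_step h x
    set u := ((perm π.1)⁻¹ * perm ρ.1) x with hu
    set z := perm ρ.1 x with hz
    have huz : perm π.1 u = z := (perm π.1).apply_symm_apply z
    have hzB : z ∈ π.1.part u := huz ▸ perm_mem_part π.1 u
    have huB := self_mem_part π.1 u
    have hCu : ρ.1.part u = ρ.1.part x := ρ.1.part_eq_of_mem (part_mem_parts ρ.1 x) h1
    have hB : π.1.part u ∈ blocksIn π.1.parts (ρ.1.part x) :=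
      mem_blocksIn.2 ⟨part_mem_parts π.1 u, hCu ▸ part_subset_part h u⟩
    have hsx := perm_spec ρ.1 x
    rw [← hz] at hsx
    rcases hsx with ⟨hxz, hnext⟩ | hend
    · have hzy := hnext y hy hlt
      have hiff := hrel.iff hB hzB huB
      have hxu : x < u := by
        by_contra hc
        have hux := not_lt.1 hc
        exact hxz.not_ge (hiff.2 ⟨fun h => h.trans hxy, fun _ => hux⟩ |>.2 hzy)
      have huy : u ≤ y := by
        by_contra hc
        exact hxz.not_ge (hiff.2 ⟨fun h => absurd hxu h.not_gt, fun h => absurd h hc⟩ |>.2 hzy)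
      have hrec : ((perm π.1)⁻¹ * perm ρ.1).SameCycle u y := by
        refine ih ((y : ℕ) - u) ?_ huy (hCu.symm ▸ hy) ?_ rfl
        · have h3 : (x : ℕ) < u := hxu
          have h4 : (u : ℕ) ≤ y := huy
          omega
        · rw [hCu]
          exact (krewerasRel_symm.1 h2).trans hrel
      refine Equiv.Perm.SameCycle.trans ⟨1, ?_⟩ hrec
      rw [zpow_one]
    · exact absurd (hend y hy).2 hlt.not_ge

theorem sameCycle_iff_krewerasRel {π ρ : NC n} (h : π ≤ ρ) (x y : Fin n) :
    ((perm π.1)⁻¹ * perm ρ.1).SameCycle x y ↔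
      y ∈ ρ.1.part x ∧ KrewerasRel (blocksIn π.1.parts (ρ.1.part x)) x y := by
  constructor
  · intro hs
    obtain ⟨i, -, rfl⟩ := hs.exists_pow_eq'
    induction i with
    | zero => exact ⟨self_mem_part _ _, krewerasRel_refl _ _⟩
    | succ i ih =>
      obtain ⟨h1, h2⟩ := ih ⟨i, rfl⟩
      obtain ⟨h3, h4⟩ := krewerasRel_step h ((((perm π.1)⁻¹ * perm ρ.1) ^ i) x)
      rw [ρ.1.part_eq_of_mem (part_mem_parts ρ.1 x) h1] at h3 h4
      rw [pow_succ', Equiv.Perm.mul_apply]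
      exact ⟨h3, h2.trans h4⟩
  · rintro ⟨hy, hrel⟩
    rcases le_total x y with hxy | hxy
    · exact sameCycle_of_krewerasRel h hxy hy hrel
    · have hC : ρ.1.part y = ρ.1.part x := ρ.1.part_eq_of_mem (part_mem_parts ρ.1 x) hy
      refine (sameCycle_of_krewerasRel h hxy ?_ ?_).symm
      · rw [hC]
        exact self_mem_part _ _
      · rw [hC]
        exact krewerasRel_symm.1 hrel

/-- This turns the cycles of `P_π⁻¹ P_ρ` into ordinary Kreweras complements, taken separately inside
each block of `ρ`. -/
theorem part_relKreweras {π ρ : NC n} (h : π ≤ ρ) (x : Fin n) :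
    (relKreweras ρ π).part x =
      krewerasBlock (ρ.1.part x) (blocksIn π.1.parts (ρ.1.part x)) x := by
  ext y
  rw [mem_krewerasBlock, ← sameCycle_iff_krewerasRel h]
  exact @Finpartition.mem_part_ofSetoid_iff_rel _ _ x _
      (Equiv.Perm.SameCycle.setoid ((perm π.1)⁻¹ * perm ρ.1)) (_) y

end RelKreweras

/-! ### Sums over intervals of non-crossing partitions -/

section KrewerasWeight

variable {α : Type*} [LinearOrder α]

open Classical in
/-- The product of `f` over the blocks of the Kreweras complement of `P`. -/
noncomputable def krewerasWeight (f : Finset α → ℂ) (S : Finset α) (P : Finset (Finset α)) : ℂ :=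
  ∏ z ∈ S, if ∃ z' ∈ S, z' < z ∧ KrewerasRel P z' z then 1 else f (krewerasBlock S P z)

theorem krewerasRel_of_mem_outerBlock {S : Finset α} {P : Finset (Finset α)} {z z' : α}
    (hz : z ∈ outerBlock S P) (hz' : z' ∈ outerBlock S P) : KrewerasRel P z z' := by
  intro B hB a ha b hb hab
  have h1 : a ≤ z ↔ b ≤ z := (mem_outerBlock.1 hz).2.iff hB ha hb
  have h2 : a ≤ z' ↔ b ≤ z' := (mem_outerBlock.1 hz').2.iff hB ha hb
  rwa [h1, h2] at hab

theorem mem_outerBlock_of_krewerasRel {S : Finset α} {P : Finset (Finset α)} {z z' : α}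
    (hz : z ∈ outerBlock S P) (hz' : z' ∈ S) (h : KrewerasRel P z z') : z' ∈ outerBlock S P := by
  refine mem_outerBlock.2 ⟨hz', fun B hB a ha b hb hab => ?_⟩
  have h1 : a ≤ z ↔ b ≤ z := (mem_outerBlock.1 hz).2.iff hB ha hb
  have h2 : (a ≤ z ↔ a ≤ z') ↔ (b ≤ z ↔ b ≤ z') := h.iff hB ha hb
  rw [h1] at h2
  grind

/-- The outer block contains the maximum of `S`, so it is a genuine block of the complement; its
factor is charged to its least element `m`. -/
theorem krewerasWeight_eq (f : Finset α → ℂ) {S : Finset α} {P : Finset (Finset α)}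
    (hS : S.Nonempty) (hP : ∀ B ∈ P, B ⊆ S) :
    krewerasWeight f S P = f (outerBlock S P) * innerWeight f S P := by
  classical
  have hne : (outerBlock S P).Nonempty := ⟨S.max' hS, mem_outerBlock.2 ⟨S.max'_mem hS,
    saturated_of_forall hP fun a ha => S.le_max' a ha⟩⟩
  set m := (outerBlock S P).min' hne with hm
  have hmo : m ∈ outerBlock S P := Finset.min'_mem _ hne
  have hmS : m ∈ S := (mem_outerBlock.1 hmo).1
  have e : f (outerBlock S P) = ∏ z ∈ S, if m = z then f (outerBlock S P) else 1 := by
    rw [Finset.prod_ite_eq, if_pos hmS]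
  rw [e, krewerasWeight, innerWeight, ← Finset.prod_mul_distrib]
  refine Finset.prod_congr rfl fun z hz => ?_
  by_cases hzo : z ∈ outerBlock S P
  · rw [if_pos (Or.inl hzo : z ∈ outerBlock S P ∨ _), mul_one]
    by_cases hmz : m = z
    · rw [if_pos hmz, if_neg]
      · congr 1
        ext u
        rw [mem_krewerasBlock]
        exact ⟨fun h => mem_outerBlock_of_krewerasRel hzo h.1 h.2,
          fun h => ⟨(mem_outerBlock.1 h).1, krewerasRel_of_mem_outerBlock hzo h⟩⟩
      · rintro ⟨u, hu, hlt, h⟩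
        have := Finset.min'_le _ _ (mem_outerBlock_of_krewerasRel hzo hu (krewerasRel_symm.1 h))
        exact (hmz ▸ hlt).not_ge this
    · rw [if_neg hmz, if_pos]
      exact ⟨m, hmS, lt_of_le_of_ne (Finset.min'_le _ _ hzo) hmz,
        krewerasRel_of_mem_outerBlock hmo hzo⟩
  · have hmz : m ≠ z := fun h => hzo (h ▸ hmo)
    simp only [hzo, false_or, hmz, if_false, one_mul]

theorem sum_ncp_krewerasWeight {β : Type*} (w : α → β) (g f : List β → ℂ) {S : Finset α}
    (hS : S.Nonempty) :
    ∑ P ∈ ncp S, (∏ B ∈ P, g (wordOn w B)) * krewerasWeight (fun B => f (wordOn w B)) S P =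
      box g f f (wordOn w S) := by
  rw [← ncpSum_eq_box, ncpSum]
  refine Finset.sum_congr rfl fun P hP => ?_
  rw [krewerasWeight_eq _ hS (mem_ncp.1 hP).subset]

theorem sum_ncp_prod {β : Type*} (w : α → β) (g : List β → ℂ) (S : Finset α) :
    ∑ P ∈ ncp S, ∏ B ∈ P, g (wordOn w B) = fock g vac (wordOn w S) := by
  rw [← box_one, ← ncpSum_eq_box, ncpSum]
  refine Finset.sum_congr rfl fun P _ => ?_
  simp [innerWeight]

end KrewerasWeight

section Intervals

variable {n : ℕ}

theorem isNCP_blocksIn {π ρ : NC n} (h : π ≤ ρ) {C : Finset (Fin n)} (hC : C ∈ ρ.1.parts) :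
    IsNCP C (blocksIn π.1.parts C) where
  nonempty _ hB := π.1.nonempty_of_mem_parts (mem_blocksIn.1 hB).1
  subset _ hB := (mem_blocksIn.1 hB).2
  cover x hx := ⟨π.1.part x, mem_blocksIn.2 ⟨part_mem_parts π.1 x,
    ρ.1.part_eq_of_mem hC hx ▸ part_subset_part h x⟩, self_mem_part π.1 x⟩
  eq_of_mem _ hB _ hD _ hxB hxD :=
    π.1.eq_of_mem_parts (mem_blocksIn.1 hB).1 (mem_blocksIn.1 hD).1 hxB hxD
  noncrossing B hB D hD := π.2 B (mem_blocksIn.1 hB).1 D (mem_blocksIn.1 hD).1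

/-- Non-crossing partitions of the blocks of `ρ` form a non-crossing partition below `ρ`. -/
theorem exists_le_blocksIn_eq (ρ : NC n)
    (p : ∀ C ∈ ρ.1.parts, Finset (Finset (Fin n))) (hp : ∀ C hC, IsNCP C (p C hC)) :
    ∃ π : NC n, π ≤ ρ ∧ ∀ C hC, blocksIn π.1.parts C = p C hC := by
  classical
  set Q : Finset (Finset (Fin n)) := ρ.1.parts.attach.biUnion fun C => p C.1 C.2 with hQ
  have mQ : ∀ {B}, B ∈ Q ↔ ∃ C hC, B ∈ p C hC := by
    intro B
    simp [hQ]
  have heq : ∀ B ∈ Q, ∀ D ∈ Q, ∀ x, x ∈ B → x ∈ D → B = D := by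
    intro B hB D hD x hxB hxD
    obtain ⟨C, hC, hB⟩ := mQ.1 hB
    obtain ⟨C', hC', hD⟩ := mQ.1 hD
    obtain rfl := ρ.1.eq_of_mem_parts hC hC' ((hp C hC).subset B hB hxB)
      ((hp C' hC').subset D hD hxD)
    exact (hp C hC).eq_of_mem B hB D hD x hxB hxD
  let π : Finpartition (Finset.univ : Finset (Fin n)) :=
    Finpartition.ofExistsUnique Q (fun B _ => Finset.subset_univ B) (by
      intro x _
      obtain ⟨B, hB, hxB⟩ := (hp _ (part_mem_parts ρ.1 x)).cover x (self_mem_part ρ.1 x)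
      have hBQ : B ∈ Q := mQ.2 ⟨_, _, hB⟩
      exact ⟨B, ⟨hBQ, hxB⟩, fun D hD => heq D hD.1 B hBQ x hD.2 hxB⟩) (by
      intro h
      obtain ⟨C, hC, h⟩ := mQ.1 h
      exact Finset.not_nonempty_empty ((hp C hC).nonempty _ h))
  have hπ : π.parts = Q := rfl
  refine ⟨⟨π, ?_⟩, ?_, ?_⟩
  · intro B hB D hD a b c d hab hbc hcd ha hb hc hd
    obtain ⟨C, hC, hB'⟩ := mQ.1 hB
    obtain ⟨C', hC', hD'⟩ := mQ.1 hD
    have sB := (hp C hC).subset B hB'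
    have sD := (hp C' hC').subset D hD'
    obtain rfl := ρ.2 C hC C' hC' a b c d hab hbc hcd (sB ha) (sD hb) (sB hc) (sD hd)
    exact (hp C hC).noncrossing B hB' D hD' a b c d hab hbc hcd ha hb hc hd
  · intro B hB
    obtain ⟨C, hC, hB'⟩ := mQ.1 hB
    exact ⟨C, hC, (hp C hC).subset B hB'⟩
  · intro C hC
    ext B
    rw [mem_blocksIn]
    constructor
    · rintro ⟨hB, hBC⟩
      obtain ⟨C', hC', hB'⟩ := mQ.1 hB
      obtain ⟨x, hx⟩ := (hp C' hC').nonempty B hB'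
      obtain rfl := ρ.1.eq_of_mem_parts hC hC' (hBC hx) ((hp C' hC').subset B hB' hx)
      exact hB'
    · exact fun hB => ⟨mQ.2 ⟨C, hC, hB⟩, (hp C hC).subset B hB⟩

open Classical in
/-- The interval below `ρ` is the product of the lattices of non-crossing partitions of the blocks
of `ρ`. -/
theorem sum_le_prod_blocksIn (ρ : NC n) (W : Finset (Fin n) → Finset (Finset (Fin n)) → ℂ) :
    ∑ π ∈ (Finset.univ : Finset (NC n)).filter (· ≤ ρ),
        ∏ C ∈ ρ.1.parts, W C (blocksIn π.1.parts C) =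
      ∏ C ∈ ρ.1.parts, ∑ P ∈ ncp C, W C P := by
  rw [Finset.prod_sum]
  refine Finset.sum_bij (fun π _ => fun C _ => blocksIn π.1.parts C) ?_ ?_ ?_ ?_
  · intro π hπ
    rw [Finset.mem_pi]
    exact fun C hC => mem_ncp.2 (isNCP_blocksIn (Finset.mem_filter.1 hπ).2 hC)
  · intro π hπ π' hπ' h
    have key : ∀ {π π' : NC n}, π ≤ ρ → (∀ C ∈ ρ.1.parts, blocksIn π.1.parts C =
        blocksIn π'.1.parts C) → π.1.parts ⊆ π'.1.parts := by
      intro π π' hle h B hB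
      obtain ⟨C, hC, hBC⟩ := hle hB
      exact (mem_blocksIn.1 (h C hC ▸ mem_blocksIn.2 ⟨hB, hBC⟩)).1
    have h' : ∀ C ∈ ρ.1.parts, blocksIn π.1.parts C = blocksIn π'.1.parts C :=
      fun C hC => congrFun (congrFun h C) hC
    exact Subtype.ext (Finpartition.ext (Finset.Subset.antisymm
      (key (Finset.mem_filter.1 hπ).2 h')
      (key (Finset.mem_filter.1 hπ').2 fun C hC => (h' C hC).symm)))
  · intro p hp
    rw [Finset.mem_pi] at hp
    obtain ⟨π, hle, h⟩ := exists_le_blocksIn_eq ρ p fun C hC => mem_ncp.1 (hp C hC)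
    exact ⟨π, Finset.mem_filter.2 ⟨Finset.mem_univ _, hle⟩, funext fun C => funext fun hC => h C hC⟩
  · intro π _
    exact (Finset.prod_attach ρ.1.parts fun C => W C (blocksIn π.1.parts C)).symm

theorem prod_parts_eq_prod_blocksIn {π ρ : NC n} (h : π ≤ ρ) (F : Finset (Fin n) → ℂ) :
    ∏ B ∈ π.1.parts, F B = ∏ C ∈ ρ.1.parts, ∏ B ∈ blocksIn π.1.parts C, F B := by
  rw [← Finset.prod_biUnion]
  · congr 1
    ext B
    rw [Finset.mem_biUnion]
    constructor
    · intro hB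
      obtain ⟨C, hC, hBC⟩ := h hB
      exact ⟨C, hC, mem_blocksIn.2 ⟨hB, hBC⟩⟩
    · rintro ⟨C, hC, hB⟩
      exact (mem_blocksIn.1 hB).1
  · intro C hC D hD hCD
    refine Finset.disjoint_left.2 fun B hB hB' => hCD ?_
    obtain ⟨x, hx⟩ := π.1.nonempty_of_mem_parts (mem_blocksIn.1 hB).1
    exact ρ.1.eq_of_mem_parts hC hD ((mem_blocksIn.1 hB).2 hx) ((mem_blocksIn.1 hB').2 hx)

theorem prod_univ_eq_prod_parts (ρ : Finpartition (Finset.univ : Finset (Fin n))) (F : Fin n → ℂ) :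
    ∏ x, F x = ∏ C ∈ ρ.parts, ∏ x ∈ C, F x := by
  have h := Finset.prod_biUnion (f := F) (t := id) ρ.disjoint
  rwa [ρ.biUnion_parts] at h

open Classical in
theorem prod_parts_eq_prod_least (P : Finpartition (Finset.univ : Finset (Fin n)))
    (F : Finset (Fin n) → ℂ) :
    ∏ B ∈ P.parts, F B = ∏ x, if ∃ x' ∈ P.part x, x' < x then 1 else F (P.part x) := by
  rw [Finset.prod_ite, Finset.prod_const_one, one_mul]
  symm
  refine Finset.prod_nbij P.part (fun x _ => part_mem_parts P x) ?_ ?_ fun x _ => rfl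
  · intro x hx y hy hxy
    simp only [Finset.coe_filter, Finset.mem_univ, true_and, not_exists, not_and, not_lt,
      Set.mem_ofPred_eq] at hx hy
    have hxy' : P.part x = P.part y := hxy
    exact le_antisymm (hx y (hxy' ▸ self_mem_part P y)) (hy x (hxy'.symm ▸ self_mem_part P x))
  · intro B hB
    have hne := P.nonempty_of_mem_parts hB
    have hpart : P.part (B.min' hne) = B := P.part_eq_of_mem hB (B.min'_mem hne)
    refine ⟨B.min' hne, ?_, hpart⟩
    simp only [Finset.coe_filter, Finset.mem_univ, true_and, not_exists, not_and, not_lt,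
      Set.mem_ofPred_eq, hpart]
    exact fun x hx => B.min'_le x hx

/-- Each block of the complement is counted at its least element, and the points are grouped by the
blocks of `ρ`. -/
theorem prod_relKreweras {π ρ : NC n} (h : π ≤ ρ) (F : Finset (Fin n) → ℂ) :
    ∏ B ∈ (relKreweras ρ π).parts, F B =
      ∏ C ∈ ρ.1.parts, krewerasWeight F C (blocksIn π.1.parts C) := by
  classical
  rw [prod_parts_eq_prod_least, prod_univ_eq_prod_parts ρ.1]
  refine Finset.prod_congr rfl fun C hC => Finset.prod_congr rfl fun x hx => ?_
  have hpart := ρ.1.part_eq_of_mem hC hx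
  rw [part_relKreweras h, hpart]
  by_cases hex : ∃ y ∈ C, y < x ∧ KrewerasRel (blocksIn π.1.parts C) y x
  · rw [if_pos hex, if_pos]
    obtain ⟨y, hy, hlt, hrel⟩ := hex
    exact ⟨y, mem_krewerasBlock.2 ⟨hy, krewerasRel_symm.1 hrel⟩, hlt⟩
  · rw [if_neg hex, if_neg]
    rintro ⟨y, hy, hlt⟩
    rw [mem_krewerasBlock] at hy
    exact hex ⟨y, hy.1, hlt, krewerasRel_symm.1 hy.2⟩

open Classical in
/-- Multiplicativity of the boxed convolution on the intervals below `ρ`. -/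
theorem sum_CfPart_mul_CfPart_relKreweras {k : ℕ} (w : Fin n → Fin k) (ρ : NC n)
    (g f : Series k) :
    ∑ π ∈ (Finset.univ : Finset (NC n)).filter (· ≤ ρ),
        CfPart w π.1 g * CfPart w (relKreweras ρ π) f =
      ∏ C ∈ ρ.1.parts, box g.coeff f.coeff f.coeff (restrictWord w C) := by
  have h1 : ∀ C ∈ ρ.1.parts, box g.coeff f.coeff f.coeff (restrictWord w C) =
      ∑ P ∈ ncp C, (∏ B ∈ P, g.coeff (wordOn w B)) *
        krewerasWeight (fun B => f.coeff (wordOn w B)) C P :=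
    fun C hC => (sum_ncp_krewerasWeight w _ _ (ρ.1.nonempty_of_mem_parts hC)).symm
  rw [Finset.prod_congr rfl h1, ← sum_le_prod_blocksIn]
  refine Finset.sum_congr rfl fun π hπ => ?_
  have hle := (Finset.mem_filter.1 hπ).2
  rw [Finset.prod_mul_distrib, ← prod_parts_eq_prod_blocksIn hle, ← prod_relKreweras hle]
  rfl

theorem parts_one (hn : 1 ≤ n) : (NC.one n).1.parts = {Finset.univ} := by
  have : Nonempty (Fin n) := ⟨⟨0, hn⟩⟩
  exact (Finset.subset_singleton_iff.1 (Finpartition.parts_top_subset _)).resolve_left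
    (Finpartition.parts_nonempty _ Finset.univ_nonempty.ne_empty).ne_empty

theorem NC.le_one (π : NC n) : π ≤ NC.one n := by
  have : π.1 ≤ (⊤ : Finpartition (Finset.univ : Finset (Fin n))) := le_top
  exact this

theorem NC.zero_le (π : NC n) : NC.zero n ≤ π := by
  have : (⊥ : Finpartition (Finset.univ : Finset (Fin n))) ≤ π.1 := bot_le
  exact this

theorem restrictWord_univ {k : ℕ} (w : Fin n → Fin k) :
    restrictWord w Finset.univ = List.ofFn w := by
  rw [restrictWord, Fin.sort_univ, List.ofFn_eq_map]

/-- The moment-cumulant formula in terms of Fock space operators. -/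
theorem sum_CfPart_eq_fock {k : ℕ} (hn : 1 ≤ n) (w : Fin n → Fin k) (f : Series k) :
    ∑ π : NC n, CfPart w π.1 f = fock f.coeff vac (List.ofFn w) := by
  classical
  have key := sum_le_prod_blocksIn (NC.one n) fun _ P => ∏ B ∈ P, f.coeff (wordOn w B)
  rw [parts_one hn, Finset.prod_singleton, sum_ncp_prod] at key
  rw [← restrictWord_univ w]
  refine Eq.trans ?_ key
  rw [Finset.filter_true_of_mem fun π _ => NC.le_one π]
  refine Finset.sum_congr rfl fun π _ => ?_
  rw [← parts_one hn, ← prod_parts_eq_prod_blocksIn (NC.le_one π)]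
  rfl

end Intervals

/-! ### `R`-transforms and boxed convolution -/

theorem UnitalFunctional.monomial_nil {k : ℕ} (μ : Distribution k) : μ (monomial []) = 1 :=
  μ.map_one

theorem isRTransform_iff {k : ℕ} (μ : Distribution k) (f : Series k) :
    IsRTransform μ f ↔ ∀ w, μ (monomial w) = fock f.coeff vac w := by
  constructor
  · intro h w
    rcases w with _ | ⟨i, w⟩
    · exact μ.monomial_nil
    · have key := h (i :: w).length (by simp) (i :: w).get
      rwa [sum_CfPart_eq_fock (by simp), List.ofFn_get] at key
  · intro h n hn w
    rw [h, sum_CfPart_eq_fock hn]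

/-- The boxed convolution of two series. -/
noncomputable def boxConv {k : ℕ} (g f : Series k) : Series k where
  coeff := box g.coeff f.coeff f.coeff
  coeff_nil := f.coeff_nil

/-- The `R`-transform of a free multiplicative convolution is the boxed convolution of the
`R`-transforms. -/
theorem IsFreeMulConv.isRTransform_boxConv {k : ℕ} {μ ν ρ : Distribution k}
    (h : IsFreeMulConv μ ν ρ) {g f : Series k} (hg : IsRTransform μ g) (hf : IsRTransform ν f) :
    IsRTransform ρ (boxConv g f) := by
  rw [isRTransform_iff] at hf hg ⊢
  exact h.apply_monomial hg hf

/-- The series `z_0 + ⋯ + z_{k-1}`, the unit of the boxed convolution. -/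
noncomputable def unitSeries (k : ℕ) : Series k where
  coeff l := if l.length = 1 then 1 else 0
  coeff_nil := by simp

/-- With cumulants supported on words of length one, every letter fixes `vac`, so all moments equal
`1`. -/
theorem isRTransform_unitDistribution (k : ℕ) :
    IsRTransform (unitDistribution k) (unitSeries k) := by
  rw [isRTransform_iff]
  intro w
  have h : ∀ x, act (unitSeries k).coeff x vac = vac := by
    intro x
    have : shift x (unitSeries k).coeff = vac := by
      funext s
      cases s <;> simp [unitSeries]
    rw [act_eq, shift_vac, this, conv_vac, zero_add]
  induction w with
  | nil => exact (unitDistribution k).monomial_nil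
  | cons x w ih =>
    rw [fock, h, ← ih]
    simp [unitDistribution, monomial]

theorem Distribution.apply_ι {k : ℕ} {μ : Distribution k} {f : Series k} (hf : IsRTransform μ f)
    (i : Fin k) : μ (FreeAlgebra.ι ℂ i) = f.coeff [i] := by
  have h := (isRTransform_iff μ f).1 hf [i]
  simpa [monomial, fock, act, conv] using h

/-! ### Sums over chains -/

section Chains

variable {α : Type*} [PartialOrder α] [Fintype α]

open Classical in
/-- Recursive description of alternating sums over chains. -/
theorem eq_sum_chains (a : α) (F : α → α → ℂ) (G : α → ℂ) (h0 : G a = 1)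
    (hG : ∀ ρ, ρ ≠ a → G ρ = -∑ π ∈ Finset.univ.filter (· < ρ), G π * F π ρ) (ρ : α) :
    G ρ = ∑ Γ ∈ (Finset.univ : Finset (LTSeries α)).filter
      (fun Γ => Γ.head = a ∧ Γ.last = ρ),
        (-1 : ℂ) ^ Γ.length * ∏ j : Fin Γ.length, F (Γ j.castSucc) (Γ j.succ) := by
  induction ρ using WellFoundedLT.induction with
  | _ ρ ih =>
    by_cases hρ : ρ = a
    · subst hρ
      have hs : (Finset.univ : Finset (LTSeries α)).filter (fun Γ => Γ.head = ρ ∧ Γ.last = ρ) =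
          {RelSeries.singleton _ ρ} := by
        ext Γ
        simp only [Finset.mem_filter, Finset.mem_univ, true_and, Finset.mem_singleton]
        constructor
        · rintro ⟨hh, hl⟩
          -- A strictly increasing chain of positive length has distinct ends, so only the chain of
          -- length `0` contributes.
          have hlen : Γ.length = 0 := by
            by_contra hne
            have h1 := Γ.strictMono (show (0 : Fin (Γ.length + 1)) < Fin.last _ from
              Fin.lt_def.2 (Nat.pos_of_ne_zero hne))
            exact h1.ne (hh.trans hl.symm)
          refine RelSeries.ext hlen ?_
          funext j
          have hj : j = 0 := Fin.ext (by have := j.2; simp; omega)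
          rw [hj]
          exact hh
        · rintro rfl
          exact ⟨rfl, rfl⟩
      rw [hs, Finset.sum_singleton, h0]
      exact ((congrArg₂ (· * ·) (pow_zero (-1 : ℂ))
        (Finset.prod_eq_one fun j _ => Fin.elim0 j)).trans (mul_one 1)).symm
    · rw [hG ρ hρ, Finset.sum_congr rfl fun π hπ => by rw [ih π (Finset.mem_filter.1 hπ).2]]
      rw [← Finset.sum_neg_distrib]
      simp only [Finset.sum_mul, ← Finset.sum_neg_distrib]
      rw [Finset.sum_sigma']
      -- A chain from `a` to `ρ` is a chain from `a` to some `π < ρ`, extended by `ρ`; the extension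
      -- contributes one sign and the factor `F π ρ`.
      refine Finset.sum_bij (fun q hq => q.2.snoc ρ ?_) ?_ ?_ ?_ ?_
      · simp only [Finset.mem_sigma, Finset.mem_filter, Finset.mem_univ, true_and] at hq
        exact hq.2.2.symm ▸ hq.1
      · rintro ⟨π, Γ⟩ hq
        simp only [Finset.mem_sigma, Finset.mem_filter, Finset.mem_univ, true_and] at hq ⊢
        exact ⟨(RelSeries.head_snoc ..).trans hq.2.1, RelSeries.last_snoc ..⟩
      · rintro ⟨π, Γ⟩ hq ⟨π', Γ'⟩ hq' h
        simp only [Finset.mem_sigma, Finset.mem_filter, Finset.mem_univ, true_and] at hq hq'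
        have h' := congrArg RelSeries.toList h
        rw [RelSeries.toList_snoc, RelSeries.toList_snoc] at h'
        obtain rfl := RelSeries.toList_injective (List.append_cancel_right h')
        obtain rfl := hq.2.2.symm.trans hq'.2.2
        rfl
      · intro Γ hΓ
        simp only [Finset.mem_filter, Finset.mem_univ, true_and] at hΓ
        have hlen : Γ.length ≠ 0 := by
          intro h
          apply hρ
          rw [← hΓ.1, ← hΓ.2]
          exact congrArg Γ (Fin.ext h)
        have hlast := Γ.eraseLast_last_rel_last hlen
        refine ⟨⟨Γ.eraseLast.last, Γ.eraseLast⟩, ?_, ?_⟩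
        · simp only [Finset.mem_sigma, Finset.mem_filter, Finset.mem_univ, true_and]
          exact ⟨hΓ.2 ▸ hlast, hΓ.1, trivial⟩
        · obtain ⟨-, rfl⟩ := hΓ
          exact Γ.snoc_self_eraseLast hlen
      · rintro ⟨π, Γ⟩ hq
        simp only [Finset.mem_sigma, Finset.mem_filter, Finset.mem_univ, true_and] at hq
        obtain ⟨hlt, hh, rfl⟩ := hq
        change _ = (-1 : ℂ) ^ (Γ.length + 1) * ∏ j : Fin (Γ.length + 1),
          F (Γ.snoc ρ hlt j.castSucc) (Γ.snoc ρ hlt j.succ)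
        rw [Fin.prod_univ_castSucc]
        have e1 : ∀ j : Fin Γ.length, Γ.snoc ρ hlt j.castSucc.castSucc = Γ j.castSucc :=
          fun j => RelSeries.snoc_castSucc ..
        have e2 : ∀ j : Fin Γ.length, Γ.snoc ρ hlt j.castSucc.succ = Γ j.succ :=
          fun j => RelSeries.snoc_castSucc Γ ρ hlt j.succ
        have e3 : Γ.snoc ρ hlt (Fin.last Γ.length).castSucc = Γ.last :=
          RelSeries.snoc_castSucc ..
        have e4 : Γ.snoc ρ hlt (Fin.last Γ.length).succ = ρ := RelSeries.last_snoc' ..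
        simp only [e1, e2]
        rw [e3, e4]
        ring

end Chains

/-! ### Unit series, singletons and the boundary terms of the recursion -/

section Inverse

variable {n k : ℕ}

/-- `0_n` is the only partition all of whose blocks are singletons. -/
theorem CfPart_unitSeries_of_ne {ρ : NC n} (hρ : ρ ≠ NC.zero n) (w : Fin n → Fin k) :
    CfPart w ρ.1 (unitSeries k) = 0 := by
  have h : ∃ C ∈ ρ.1.parts, C.card ≠ 1 := by
    by_contra! hall
    refine hρ (le_antisymm ?_ (NC.zero_le ρ))
    intro C hC
    obtain ⟨x, rfl⟩ := Finset.card_eq_one.1 (hall C hC)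
    exact ⟨{x}, Finpartition.mem_bot_iff.2 ⟨x, Finset.mem_univ x, rfl⟩, le_rfl⟩
  obtain ⟨C, hC, hcard⟩ := h
  refine Finset.prod_eq_zero hC ?_
  simp [unitSeries, length_restrictWord, hcard]

theorem CfPart_zero {f : Series k} (hf : ∀ i, f.coeff [i] = 1) (w : Fin n → Fin k) :
    CfPart w (NC.zero n).1 f = 1 := by
  refine Finset.prod_eq_one fun B hB => ?_
  obtain ⟨x, -, rfl⟩ := Finpartition.mem_bot_iff.1 hB
  simp [restrictWord, hf]

/-- `P_ρ⁻¹ P_ρ` is the identity, so every block of the complement is a fixed point. -/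
theorem CfPart_relKreweras_self {f : Series k} (hf : ∀ i, f.coeff [i] = 1) (w : Fin n → Fin k)
    (ρ : NC n) : CfPart w (relKreweras ρ ρ) f = 1 := by
  refine Finset.prod_eq_one fun B hB => ?_
  obtain ⟨x, hx⟩ := (relKreweras ρ ρ).nonempty_of_mem_parts hB
  have hBx : B = {x} := by
    rw [← (relKreweras ρ ρ).part_eq_of_mem hB hx]
    ext y
    have h := @Finpartition.mem_part_ofSetoid_iff_rel _ _ x _
      (Equiv.Perm.SameCycle.setoid ((perm ρ.1)⁻¹ * perm ρ.1)) (Classical.decRel _) y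
    refine h.trans ?_
    change ((perm ρ.1)⁻¹ * perm ρ.1).SameCycle x y ↔ _
    rw [inv_mul_cancel, Equiv.Perm.sameCycle_one, Finset.mem_singleton, eq_comm]
  rw [hBx]
  simp [restrictWord, hf]

end Inverse

end FreeProb

theorem proposition4p7 {k : ℕ} (μ ν : FreeProb.Distribution k) (hμ : μ ∈ FreeProb.G k)
    (hν : FreeProb.IsFreeMulInverse μ ν) {n : ℕ} (hn : 2 ≤ n) (w : Fin n → Fin k) :
    FreeProb.Cf w (FreeProb.RTransform ν) =
      ∑ Γ : FreeProb.Chain n,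
        (-1 : ℂ) ^ Γ.1.length * FreeProb.CfChain w Γ (FreeProb.RTransform μ) := by
  classical
  open FreeProb in
  set f := RTransform μ with hf
  set g := RTransform ν with hg
  have hfR : IsRTransform μ f := isRTransform_RTransform μ
  have hgR : IsRTransform ν g := isRTransform_RTransform ν
  -- The order `ν ⊠ μ` is the useful one: it puts `g` on `π` and `f` on the complement, which
  -- matches the factors of a chain.
  have hbox : boxConv g f = unitSeries k :=
    (hν.2.isRTransform_boxConv hgR hfR).unique (isRTransform_unitDistribution k)
  have hf1 : ∀ i, f.coeff [i] = 1 := fun i => by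
    rw [← Distribution.apply_ι hfR]
    exact hμ i
  -- On a one-letter word the boxed convolution is the product of the two coefficients.
  have hg1 : ∀ i, g.coeff [i] = 1 := fun i => by
    have h := congrArg (fun s => s.coeff [i]) hbox
    simpa [boxConv, box_cons, blockSum_eq, cutSum, unitSeries, hf1] using h
  have hsum : ∀ ρ : NC n, ρ ≠ NC.zero n →
      ∑ π ∈ (Finset.univ : Finset (NC n)).filter (· ≤ ρ),
        CfPart w π.1 g * CfPart w (relKreweras ρ π) f = 0 := by
    intro ρ hρ
    rw [sum_CfPart_mul_CfPart_relKreweras, ← CfPart_unitSeries_of_ne hρ w, ← hbox]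
    rfl
  have hrec : ∀ ρ : NC n, ρ ≠ NC.zero n → CfPart w ρ.1 g =
      -∑ π ∈ (Finset.univ : Finset (NC n)).filter (· < ρ),
        CfPart w π.1 g * CfPart w (relKreweras ρ π) f := by
    intro ρ hρ
    have h := hsum ρ hρ
    -- Isolate the term `π = ρ`, whose Kreweras factor is `1`.
    have e : (Finset.univ : Finset (NC n)).filter (· ≤ ρ) =
        insert ρ ((Finset.univ : Finset (NC n)).filter (· < ρ)) := by
      ext π
      simp [le_iff_eq_or_lt]
    rw [e, Finset.sum_insert (by simp), CfPart_relKreweras_self hf1, mul_one] at h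
    exact eq_neg_of_add_eq_zero_left h
  have key := eq_sum_chains (NC.zero n) (fun π ρ => CfPart w (relKreweras ρ π) f)
    (fun π => CfPart w π.1 g) (CfPart_zero hg1 w) hrec (NC.one n)
  rw [CfPart_one (by omega)] at key
  rw [key]
  refine Finset.sum_subtype _ (fun Γ => ?_) _
  simp
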